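/- Let $k$ be a field and let $R$, $H$ be (unital, associative) $k$-algebras. **Corings.** A coring over $R$ is an $(R,R)$-bimodule $\mathcal C$ (with $k$ acting centrally) with bimodule maps $\Delta:\mathcal C\to\mathcal C\otimes_R\mathcal C$, $\Delta(c)=c^{(1)}\otimes_R c^{(2)}$, and $\epsilon:\mathcal C\to R$ such that $(\mathrm{id}\otimes\Delta)\Delta=(\Delta\otimes\mathrm{id})\Delta$ and $(\mathrm{id}\otimes\epsilon)\Delta=\mathrm{id}=(\epsilon\otimes\mathrm{id})\Delta$. **Para Hopf algebroids.** A bialgebroid $(H,R,\alpha,\beta,\Delta,\epsilon)$ consists of an algebra homomorphism $\alpha:R\to H$ and an antihomomorphism $\beta:R\to H$ with commuting images, and a coring structure $(\Delta,\epsilon)$ over $R$ on $H$ with the bimodule structure $axb=\alpha(a)\beta(b)x$, such that $\Delta(h)(\beta(r)\otimes1-1\otimes\alpha(r))=0$, $\Delta(gh)=\Delta(g)\Delta(h)$, $\Delta(1)=1\otimes_R1$ and $\epsilon(1)=1$. It is a para Hopf algebroid if it is equipped with a $k$-linear unital antialgebra map $T:H\to H$ with $T\beta=\alpha$, $T(h^{(1)})h^{(2)}=\beta(\epsilon(T(h)))$,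 $T^2=\mathrm{id}$ and $T(h^{(1)})^{(1)}h^{(2)}\otimes_RT(h^{(1)})^{(2)}=1\otimes_RT(h)$ for all $h\in H$. Then $H$ acts on $R$ by $h\cdot r=\epsilon(h\alpha(r))=\epsilon(h\beta(r))$, and diagonally, $h\cdot(m\otimes_R n)=h^{(1)}m\otimes_Rh^{(2)}n$, on tensor products over $R$ of left $H$-modules, where $R$ acts on an $H$-module on the left through $\alpha$ and on the right through $\beta$. **Module corings.** Let $(H,R)$ be a para Hopf algebroid. An $H$-module coring $(\mathcal C,R)$ is a coring over $R$ that is a left $H$-module, whose left and right $R$-actions are those induced by $\alpha$ and $\beta$, and whose maps $\Delta$ and $\epsilon$ are $H$-linear. It is $H$-coseparable if there is an $H$-linear map $\delta:\mathcal C\otimes_R\mathcal C\to R$ with $\delta\Delta=\epsilon$ and $(\mathrm{id}\otimes_R\delta)(\Delta\otimes_R\mathrm{id})=(\delta\otimes_R\mathrm{id})(\mathrm{id}\otimes_R\Delta)$. **Hopf-cyclic cohomology.** Regard $\mathcal C$ as a right $H$-module by $c\cdot h=T(h)c$ and put $C^n=\mathcal C\otimes_H\mathcal C^{\otimes_Rn}$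 for $n\ge0$, where $\mathcal C^{\otimes_R0}=R$. Define $\delta_0,\dots,\delta_{n+1}:C^n\to C^{n+1}$ by letting $\delta_i$, $0\le i\le n$, apply $\Delta$ to the factor $c_i$ of $c_0\otimes_Hc_1\otimes_R\cdots\otimes_Rc_n$, and $\delta_{n+1}(c_0\otimes_Hc_1\otimes_R\cdots\otimes_Rc_n)=c_0^{(2)}\otimes_Hc_1\otimes_R\cdots\otimes_Rc_n\otimes_Rc_0^{(1)}$; for $n=0$ this means $\delta_0(c\otimes_Hr)=c^{(1)}\otimes_H\beta(r)c^{(2)}$ and $\delta_1(c\otimes_Hr)=c^{(2)}\otimes_H\alpha(r)c^{(1)}$. Let $\tau(c_0\otimes_Hc_1\otimes_R\cdots\otimes_Rc_n)=c_1\otimes_Hc_2\otimes_R\cdots\otimes_Rc_n\otimes_Rc_0$ for $n\ge1$ and $\tau=\mathrm{id}$ on $C^0$. The Hopf-cyclic cohomology $HC^*_H(\mathcal C,R)$ is the cyclic cohomology of this cocyclic module, that is, the cohomology of the total complex of the first-quadrant cyclic bicomplex with $C^q$ in column $p\geq 0$ and row $q\geq 0$, vertical differentials $b=\sum_{i=0}^{q+1}(-1)^i\delta_i$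 in even columns and $-b'=-\sum_{i=0}^{q}(-1)^i\delta_i$ in odd columns, and horizontal differentials $1-\lambda$ out of even columns and $1+\lambda+\cdots+\lambda^q$ out of odd columns, where $\lambda=(-1)^q\tau$ on $C^q$. **Proposition.** If the $H$-module coring $(\mathcal C,R)$ is $H$-coseparable, then for every $n\ge0$ $$HC^n_H(\mathcal C,R)\cong HC^0_H(\mathcal C,R)\ \text{ if } n \text{ is even},\qquad HC^n_H(\mathcal C,R)=0\ \text{ if } n\text{ is odd},$$ the isomorphism being one of $k$-vector spaces. -/

import Mathlib

open scoped TensorProduct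

universe v

noncomputable section

namespace HopfCyclic

/-! ### Balanced tensor products over noncommutative rings -/

section Balanced

variable {k A M N P M₂ N₂ : Type*} [CommRing k]
  [AddCommGroup M] [Module k M] [AddCommGroup N] [Module k N] [AddCommGroup P] [Module k P]
  [AddCommGroup M₂] [Module k M₂] [AddCommGroup N₂] [Module k N₂]

/-- The relations `(m · a) ⊗ n = m ⊗ (a · n)`, where `ρ` is the right action on `M` and `l` the
left action on `N`. -/
def balRel (ρ : A → Module.End k M) (l : A → Module.End k N) : Submodule k (M ⊗[k] N) :=
  Submodule.span k {z | ∃ a m n, z = ρ a m ⊗ₜ[k] n - m ⊗ₜ[k] l a n}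

/-- The tensor product `M ⊗_A N` of a right module and a left module over a `k`-algebra `A`. -/
def Bal (ρ : A → Module.End k M) (l : A → Module.End k N) : Type _ :=
  (M ⊗[k] N) ⧸ balRel ρ l

instance instBalGroup (ρ : A → Module.End k M) (l : A → Module.End k N) :
    AddCommGroup (Bal ρ l) :=
  inferInstanceAs (AddCommGroup ((M ⊗[k] N) ⧸ balRel ρ l))

instance instBalModule (ρ : A → Module.End k M) (l : A → Module.End k N) :
    Module k (Bal ρ l) :=
  inferInstanceAs (Module k ((M ⊗[k] N) ⧸ balRel ρ l))

/-- The canonical bilinear map `(m, n) ↦ m ⊗_A n`. -/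
def Bal.mk (ρ : A → Module.End k M) (l : A → Module.End k N) : M →ₗ[k] N →ₗ[k] Bal ρ l :=
  (TensorProduct.mk k M N).compr₂ (balRel ρ l).mkQ

variable {ρ : A → Module.End k M} {l : A → Module.End k N}
  {ρ₂ : A → Module.End k M₂} {l₂ : A → Module.End k N₂}

theorem Bal.mk_bal (a : A) (m : M) (n : N) :
    Bal.mk ρ l (ρ a m) n = Bal.mk ρ l m (l a n) :=
  (Submodule.Quotient.eq _).2 (Submodule.subset_span ⟨a, m, n, rfl⟩)

/-- The linear map out of `M ⊗_A N` induced by a balanced bilinear map. -/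
def Bal.lift (f : M →ₗ[k] N →ₗ[k] P) (hf : ∀ a m n, f (ρ a m) n = f m (l a n)) :
    Bal ρ l →ₗ[k] P :=
  (balRel ρ l).liftQ (TensorProduct.lift f) (by
    rw [balRel, Submodule.span_le]
    rintro _ ⟨a, m, n, rfl⟩
    simp [hf])

@[simp] theorem Bal.lift_mk (f : M →ₗ[k] N →ₗ[k] P) (hf : ∀ a m n, f (ρ a m) n = f m (l a n))
    (m : M) (n : N) : Bal.lift f hf (Bal.mk ρ l m n) = f m n :=
  TensorProduct.lift.tmul m n

theorem Bal.ind {motive : Bal ρ l → Prop} (z : Bal ρ l)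
    (h_mk : ∀ m n, motive (Bal.mk ρ l m n))
    (h_sum : ∀ x y, motive x → motive y → motive (x + y)) : motive z := by
  obtain ⟨t, rfl⟩ := (balRel ρ l).mkQ_surjective z
  induction t using TensorProduct.induction_on with
  | zero =>
    have h := h_mk 0 0
    rw [map_zero] at h
    exact h
  | tmul m n => exact h_mk m n
  | add x y hx hy =>
    rw [map_add]
    exact h_sum _ _ hx hy

theorem Bal.hom_ext {f g : Bal ρ l →ₗ[k] P}
    (h : ∀ m n, f (Bal.mk ρ l m n) = g (Bal.mk ρ l m n)) : f = g := by
  ext z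
  induction z using Bal.ind with
  | h_mk m n => exact h m n
  | h_sum x y hx hy => rw [map_add, map_add, hx, hy]

/-- The map `f ⊗ g : M ⊗_A N → M₂ ⊗_A N₂`, for `f` right linear and `g` left linear. -/
def Bal.map (f : M →ₗ[k] M₂) (g : N →ₗ[k] N₂) (hf : ∀ a m, f (ρ a m) = ρ₂ a (f m))
    (hg : ∀ a n, g (l a n) = l₂ a (g n)) : Bal ρ l →ₗ[k] Bal ρ₂ l₂ :=
  Bal.lift ((Bal.mk ρ₂ l₂).compl₁₂ f g) (by
    intro a m n
    simp [hf, hg, Bal.mk_bal])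

@[simp] theorem Bal.map_mk (f : M →ₗ[k] M₂) (g : N →ₗ[k] N₂)
    (hf : ∀ a m, f (ρ a m) = ρ₂ a (f m)) (hg : ∀ a n, g (l a n) = l₂ a (g n)) (m : M) (n : N) :
    Bal.map f g hf hg (Bal.mk ρ l m n) = Bal.mk ρ₂ l₂ (f m) (g n) := by
  simp [Bal.map]

/-- The associativity map `(M ⊗ N) ⊗ P → M ⊗ (N ⊗ P)`, `(m ⊗ n) ⊗ p ↦ m ⊗ (n ⊗ p)`. Here `ρT` is
the right action on `M ⊗ N` through `N`, and `lT` the left action on `N ⊗ P` through `N`. -/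
def Bal.assoc {ρN : A → Module.End k N} {lP : A → Module.End k P}
    (ρT : A → Module.End k (Bal ρ l)) (lT : A → Module.End k (Bal ρN lP))
    (hρ : ∀ a m n, ρT a (Bal.mk ρ l m n) = Bal.mk ρ l m (ρN a n))
    (hl : ∀ a n p, lT a (Bal.mk ρN lP n p) = Bal.mk ρN lP (l a n) p) :
    Bal ρT lP →ₗ[k] Bal ρ lT :=
  Bal.lift
    (Bal.lift (LinearMap.mk₂ k (fun m n => (Bal.mk ρ lT m).comp (Bal.mk ρN lP n))
        (by intros; ext; simp) (by intros; ext; simp) (by intros; ext; simp)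
        (by intros; ext; simp))
      (by intro a m n; ext p; simp [Bal.mk_bal, hl]))
    (by
      intro a z p
      induction z using Bal.ind with
      | h_mk m n => simp [hρ, Bal.mk_bal]
      | h_sum x y hx hy => simp only [map_add, LinearMap.add_apply, hx, hy])

@[simp] theorem Bal.assoc_mk {ρN : A → Module.End k N} {lP : A → Module.End k P}
    (ρT : A → Module.End k (Bal ρ l)) (lT : A → Module.End k (Bal ρN lP))
    (hρ : ∀ a m n, ρT a (Bal.mk ρ l m n) = Bal.mk ρ l m (ρN a n))
    (hl : ∀ a n p, lT a (Bal.mk ρN lP n p) = Bal.mk ρN lP (l a n) p) (m : M) (n : N) (p : P) :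
    Bal.assoc ρT lT hρ hl (Bal.mk ρT lP (Bal.mk ρ l m n) p)
      = Bal.mk ρ lT m (Bal.mk ρN lP n p) := by
  simp [Bal.assoc]

/-- The inverse associativity map `m ⊗ (n ⊗ p) ↦ (m ⊗ n) ⊗ p`. -/
def Bal.assocInv {ρN : A → Module.End k N} {lP : A → Module.End k P}
    (ρT : A → Module.End k (Bal ρ l)) (lT : A → Module.End k (Bal ρN lP))
    (hρ : ∀ a m n, ρT a (Bal.mk ρ l m n) = Bal.mk ρ l m (ρN a n))
    (hl : ∀ a n p, lT a (Bal.mk ρN lP n p) = Bal.mk ρN lP (l a n) p) :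
    Bal ρ lT →ₗ[k] Bal ρT lP :=
  Bal.lift (LinearMap.flip
    (Bal.lift (LinearMap.mk₂ k
        (fun n p => ((Bal.mk ρT lP).flip p).comp ((Bal.mk ρ l).flip n))
        (by intros; ext; simp) (by intros; ext; simp) (by intros; ext; simp)
        (by intros; ext; simp))
      (by intro a n p; ext m; simp [← Bal.mk_bal, hρ])))
    (by
      intro a m z
      induction z using Bal.ind with
      | h_mk n p => simp [hl, Bal.mk_bal]
      | h_sum x y hx hy => simp only [map_add, hx, hy])

@[simp] theorem Bal.assocInv_mk {ρN : A → Module.End k N} {lP : A → Module.End k P}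
    (ρT : A → Module.End k (Bal ρ l)) (lT : A → Module.End k (Bal ρN lP))
    (hρ : ∀ a m n, ρT a (Bal.mk ρ l m n) = Bal.mk ρ l m (ρN a n))
    (hl : ∀ a n p, lT a (Bal.mk ρN lP n p) = Bal.mk ρN lP (l a n) p) (m : M) (n : N) (p : P) :
    Bal.assocInv ρT lT hρ hl (Bal.mk ρ lT m (Bal.mk ρN lP n p))
      = Bal.mk ρT lP (Bal.mk ρ l m n) p := by
  simp [Bal.assocInv]

attribute [irreducible] Bal instBalGroup instBalModule Bal.mk Bal.lift Bal.map Bal.assoc Bal.assocInv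

end Balanced

/-! ### Bimodules and corings -/

section Corings

variable (k R : Type*) [CommRing k] [Ring R] [Algebra k R]

/-- An `(R, R)`-bimodule structure on the `k`-module `M` (with `k` acting centrally): the left
action `l` and the right action `r`, which commute. -/
structure Bimod (M : Type*) [AddCommGroup M] [Module k M] where
  l : R →ₐ[k] Module.End k M
  r : Rᵐᵒᵖ →ₐ[k] Module.End k M
  comm : ∀ a b m, l a (r b m) = r b (l a m)

/-- The `k`-algebra `R` as a bimodule over itself. -/
def Bimod.regular : Bimod k R R where
  l := Algebra.lmul k R
  r := Algebra.lsmul k k R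
  comm a b m := by simp [mul_assoc]

variable {k R}

variable {M N : Type*} [AddCommGroup M] [Module k M] [AddCommGroup N] [Module k N]

/-- The underlying `k`-module of the tensor product `M ⊗_R N` of bimodules. -/
abbrev Bimod.Ten (B : Bimod k R M) (D : Bimod k R N) : Type _ :=
  Bal (fun a : R => B.r (MulOpposite.op a)) (fun a : R => D.l a)

/-- The element `m ⊗_R n`. -/
abbrev Bimod.tmul (B : Bimod k R M) (D : Bimod k R N) : M →ₗ[k] N →ₗ[k] B.Ten D :=
  Bal.mk (fun a : R => B.r (MulOpposite.op a)) (fun a : R => D.l a)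

/-- The bimodule structure of `M ⊗_R N`: `a (m ⊗ n) b = (a m) ⊗ (n b)`. -/
def Bimod.tensor (B : Bimod k R M) (D : Bimod k R N) : Bimod k R (B.Ten D) where
  l := AlgHom.ofLinearMap
    { toFun := fun a => Bal.map (B.l a) LinearMap.id (fun b m => B.comm a _ m) (fun _ _ => rfl)
      map_add' := fun a b => Bal.hom_ext fun m n => by simp
      map_smul' := fun a b => Bal.hom_ext fun m n => by simp }
    (Bal.hom_ext fun m n => by simp)
    (fun a b => Bal.hom_ext fun m n => by simp)
  r := AlgHom.ofLinearMap
    { toFun := fun a => Bal.map LinearMap.id (D.r a) (fun _ _ => rfl)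
        (fun b m => (D.comm b a m).symm)
      map_add' := fun a b => Bal.hom_ext fun m n => by simp
      map_smul' := fun a b => Bal.hom_ext fun m n => by simp }
    (Bal.hom_ext fun m n => by simp)
    (fun a b => Bal.hom_ext fun m n => by simp)
  comm a b z := by
    induction z using Bal.ind with
    | h_mk m n => simp
    | h_sum x y hx hy => simp only [map_add, hx, hy]

@[simp] theorem Bimod.tensor_l (B : Bimod k R M) (D : Bimod k R N) (a : R) (m : M) (n : N) :
    (B.tensor D).l a (B.tmul D m n) = B.tmul D (B.l a m) n := by
  simp [Bimod.tensor]

@[simp] theorem Bimod.tensor_r (B : Bimod k R M) (D : Bimod k R N) (a : Rᵐᵒᵖ) (m : M) (n : N) :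
    (B.tensor D).r a (B.tmul D m n) = B.tmul D m (D.r a n) := by
  simp [Bimod.tensor]

/-- The associativity map `(M ⊗_R M) ⊗_R M → M ⊗_R (M ⊗_R M)`. -/
def Bimod.assoc (B : Bimod k R M) : (B.tensor B).Ten B →ₗ[k] B.Ten (B.tensor B) :=
  Bal.assoc _ _ (fun _ m n => B.tensor_r B _ m n) (fun _ m n => B.tensor_l B _ m n)

/-- `M ⊗_R R → M`, `m ⊗ a ↦ m a`. -/
def Bimod.runit (B : Bimod k R M) : B.Ten (Bimod.regular k R) →ₗ[k] M :=
  Bal.lift (LinearMap.mk₂ k (fun m a => B.r (MulOpposite.op a) m)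
    (by intros; simp) (by intros; simp) (by intros; simp) (by intros; simp))
    (by intro a m n; simp [Bimod.regular])

/-- `R ⊗_R M → M`, `a ⊗ m ↦ a m`. -/
def Bimod.lunit (B : Bimod k R M) : (Bimod.regular k R).Ten B →ₗ[k] M :=
  Bal.lift (LinearMap.mk₂ k (fun a m => B.l a m)
    (by intros; simp) (by intros; simp) (by intros; simp) (by intros; simp))
    (by intro a m n; simp [Bimod.regular])

@[simp] theorem Bimod.runit_mk (B : Bimod k R M) (m : M) (a : R) :
    B.runit (B.tmul _ m a) = B.r (MulOpposite.op a) m :=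
  Bal.lift_mk _ _ m a

@[simp] theorem Bimod.lunit_mk (B : Bimod k R M) (m : M) (a : R) :
    B.lunit ((Bimod.regular k R).tmul B a m) = B.l a m :=
  Bal.lift_mk _ _ a m

/-- A coring structure over the `k`-algebra `R` on the bimodule `B`. -/
structure Coring (B : Bimod k R M) where
  comul : M →ₗ[k] B.Ten B
  comul_l : ∀ a m, comul (B.l a m) = (B.tensor B).l a (comul m)
  comul_r : ∀ a m, comul (B.r a m) = (B.tensor B).r a (comul m)
  counit : M →ₗ[k] R
  counit_l : ∀ a m, counit (B.l a m) = (Bimod.regular k R).l a (counit m)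
  counit_r : ∀ a m, counit (B.r a m) = (Bimod.regular k R).r a (counit m)
  /-- `(id ⊗ Δ) Δ = (Δ ⊗ id) Δ` -/
  coassoc : ∀ m,
    (Bal.map LinearMap.id comul (fun _ _ => rfl) comul_l : B.Ten B →ₗ[k] B.Ten (B.tensor B))
        (comul m)
      = B.assoc ((Bal.map comul LinearMap.id (fun _ => comul_r _) (fun _ _ => rfl) :
          B.Ten B →ₗ[k] (B.tensor B).Ten B) (comul m))
  /-- `(id ⊗ ε) Δ = id` -/
  id_counit : ∀ m,
    B.runit ((Bal.map LinearMap.id counit (fun _ _ => rfl) counit_l :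
      B.Ten B →ₗ[k] B.Ten (Bimod.regular k R)) (comul m)) = m
  /-- `(ε ⊗ id) Δ = id` -/
  counit_id : ∀ m,
    B.lunit ((Bal.map counit LinearMap.id (fun _ => counit_r _) (fun _ _ => rfl) :
      B.Ten B →ₗ[k] (Bimod.regular k R).Ten B) (comul m)) = m

end Corings

/-! ### Bialgebroids -/

section Bialgebroids

variable {k R H M N P : Type*} [CommRing k] [Ring R] [Algebra k R] [Ring H] [Algebra k H]
  [AddCommGroup M] [Module k M] [AddCommGroup N] [Module k N] [AddCommGroup P] [Module k P]

variable (k R H) in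
/-- An algebra homomorphism `α : R → H` and an algebra antihomomorphism `β : R → H` with
commuting images. -/
structure SrcTgt where
  α : R →ₐ[k] H
  β : Rᵐᵒᵖ →ₐ[k] H
  comm : ∀ a b, α a * β b = β b * α a

/-- The `(R, R)`-bimodule structure `a m b = α(a) β(b) m` on an `H`-module. An `H`-module is given
by the homomorphism `π` from `H` to its endomorphism algebra. -/
def SrcTgt.bimod (S : SrcTgt k R H) (π : H →ₐ[k] Module.End k M) : Bimod k R M where
  l := π.comp S.α
  r := π.comp S.β
  comm a b m := by
    have h := congrArg (fun x => π x m) (S.comm a b)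
    simpa using h

@[simp] theorem SrcTgt.bimod_l (S : SrcTgt k R H) (π : H →ₐ[k] Module.End k M) (a : R) (m : M) :
    (S.bimod π).l a m = π (S.α a) m := rfl

@[simp] theorem SrcTgt.bimod_r (S : SrcTgt k R H) (π : H →ₐ[k] Module.End k M) (a : Rᵐᵒᵖ)
    (m : M) : (S.bimod π).r a m = π (S.β a) m := rfl

/-- `M ⊗_R N` for `H`-modules `M`, `N`. -/
abbrev SrcTgt.Ten (S : SrcTgt k R H) (π : H →ₐ[k] Module.End k M)
    (σ : H →ₐ[k] Module.End k N) : Type _ :=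
  (S.bimod π).Ten (S.bimod σ)

/-- The element `m ⊗_R n`. -/
abbrev SrcTgt.tmul (S : SrcTgt k R H) (π : H →ₐ[k] Module.End k M)
    (σ : H →ₐ[k] Module.End k N) : M →ₗ[k] N →ₗ[k] S.Ten π σ :=
  (S.bimod π).tmul (S.bimod σ)

theorem SrcTgt.tmul_bal (S : SrcTgt k R H) (π : H →ₐ[k] Module.End k M)
    (σ : H →ₐ[k] Module.End k N) (a : R) (m : M) (n : N) :
    S.tmul π σ (π (S.β (MulOpposite.op a)) m) n = S.tmul π σ m (σ (S.α a) n) :=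
  Bal.mk_bal (ρ := fun a : R => (S.bimod π).r (MulOpposite.op a))
    (l := fun a : R => (S.bimod σ).l a) a m n

/-- `H` as an `(R, R)`-bimodule, `a x b = α(a) β(b) x`. -/
abbrev SrcTgt.self (S : SrcTgt k R H) : Bimod k R H := S.bimod (Algebra.lmul k H)

/-- `H ⊗_R H`. -/
abbrev SrcTgt.HH (S : SrcTgt k R H) : Type _ := S.self.Ten S.self

/-- The map `(x ⊗_R y, m, n) ↦ x m ⊗_R y n`. For `M = N = H` it is the natural right action of
`H ⊗ H` on `H ⊗_R H`. -/
def SrcTgt.pair (S : SrcTgt k R H) (π : H →ₐ[k] Module.End k M)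
    (σ : H →ₐ[k] Module.End k N) : S.HH →ₗ[k] M →ₗ[k] N →ₗ[k] S.Ten π σ :=
  Bal.lift (LinearMap.mk₂ k
      (fun x y : H => (S.tmul π σ).compl₁₂ (π x) (σ y))
      (by intros; ext; simp) (by intros; ext; simp) (by intros; ext; simp)
      (by intros; ext; simp))
    (by
      intro a x y
      ext m n
      have h := S.tmul_bal π σ a (π x m) (σ y n)
      simpa using h)

@[simp] theorem SrcTgt.pair_mk (S : SrcTgt k R H) (π : H →ₐ[k] Module.End k M)
    (σ : H →ₐ[k] Module.End k N) (x y : H) (m : M) (n : N) :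
    S.pair π σ (S.self.tmul S.self x y) m n = S.tmul π σ (π x m) (σ y n) := by
  rw [SrcTgt.pair, Bal.lift_mk]
  rfl

theorem SrcTgt.pair_pair (S : SrcTgt k R H) (π : H →ₐ[k] Module.End k M)
    (σ : H →ₐ[k] Module.End k N) (t : S.HH) (x y : H) (m : M) (n : N) :
    S.pair π σ (S.pair (Algebra.lmul k H) (Algebra.lmul k H) t x y) m n
      = S.pair π σ t (π x m) (σ y n) := by
  induction t using Bal.ind with
  | h_mk p q => simp
  | h_sum x y hx hy => simp only [map_add, LinearMap.add_apply, hx, hy]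

variable (k R H) in
/-- Auxiliary: source and target maps, a coring structure on `H`, and the condition
`Δ(h)(β(r) ⊗ 1 - 1 ⊗ α(r)) = 0`, which makes the product `Δ(h)Δ(g)` well defined. -/
structure PreBialgebroid extends SrcTgt k R H where
  coring : Coring toSrcTgt.self
  takeuchi : ∀ h r,
    toSrcTgt.pair (Algebra.lmul k H) (Algebra.lmul k H) (coring.comul h) (β (MulOpposite.op r)) 1
      = toSrcTgt.pair (Algebra.lmul k H) (Algebra.lmul k H) (coring.comul h) 1 (α r)

/-- The diagonal action `h (m ⊗_R n) = h⁽¹⁾ m ⊗_R h⁽²⁾ n`. For `M = N = H` it is the product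
`Δ(h) (x ⊗_R y)`. -/
def PreBialgebroid.diag (B : PreBialgebroid k R H) (π : H →ₐ[k] Module.End k M)
    (σ : H →ₐ[k] Module.End k N) (h : H) : B.Ten π σ →ₗ[k] B.Ten π σ :=
  Bal.lift (B.pair π σ (B.coring.comul h)) (by
    intro a m n
    have e := congrArg (fun t => B.pair π σ t m n) (B.takeuchi h a)
    simpa only [SrcTgt.pair_pair, map_one, Module.End.one_apply, SrcTgt.bimod_l, SrcTgt.bimod_r]
      using e)

@[simp] theorem PreBialgebroid.diag_mk (B : PreBialgebroid k R H) (π : H →ₐ[k] Module.End k M)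
    (σ : H →ₐ[k] Module.End k N) (h : H) (m : M) (n : N) :
    B.diag π σ h (B.tmul π σ m n) = B.pair π σ (B.coring.comul h) m n := by
  rw [PreBialgebroid.diag, Bal.lift_mk]

variable (k R H) in
/-- A bialgebroid `(H, R, α, β, Δ, ε)`. -/
structure Bialgebroid extends PreBialgebroid k R H where
  /-- `Δ(g h) = Δ(g) Δ(h)` -/
  comul_mul : ∀ g h, coring.comul (g * h)
    = toPreBialgebroid.diag (Algebra.lmul k H) (Algebra.lmul k H) g (coring.comul h)
  /-- `Δ(1) = 1 ⊗ 1` -/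
  comul_one : coring.comul 1 = toSrcTgt.self.tmul toSrcTgt.self 1 1
  counit_one : coring.counit 1 = 1

theorem Bialgebroid.pair_diag (B : Bialgebroid k R H) (π : H →ₐ[k] Module.End k M)
    (σ : H →ₐ[k] Module.End k N) (g : H) (t : B.HH) (m : M) (n : N) :
    B.pair π σ (B.diag (Algebra.lmul k H) (Algebra.lmul k H) g t) m n
      = B.diag π σ g (B.pair π σ t m n) := by
  induction t using Bal.ind with
  | h_mk p q =>
    rw [PreBialgebroid.diag_mk, SrcTgt.pair_pair, SrcTgt.pair_mk, PreBialgebroid.diag_mk]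
  | h_sum x y hx hy => simp only [map_add, LinearMap.add_apply, hx, hy]

/-- The tensor product `M ⊗_R N` of `H`-modules, as an `H`-module by the diagonal action. -/
def Bialgebroid.tens (B : Bialgebroid k R H) (π : H →ₐ[k] Module.End k M)
    (σ : H →ₐ[k] Module.End k N) : H →ₐ[k] Module.End k (B.Ten π σ) :=
  AlgHom.ofLinearMap
    { toFun := B.diag π σ
      map_add' := fun g h => Bal.hom_ext fun m n => by simp
      map_smul' := fun g h => Bal.hom_ext fun m n => by simp }
    (Bal.hom_ext fun m n => by simp [B.comul_one])
    (fun g h => Bal.hom_ext fun m n => by simp [B.comul_mul, B.pair_diag])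

@[simp] theorem Bialgebroid.tens_mk (B : Bialgebroid k R H) (π : H →ₐ[k] Module.End k M)
    (σ : H →ₐ[k] Module.End k N) (h : H) (m : M) (n : N) :
    B.tens π σ h (B.tmul π σ m n) = B.pair π σ (B.coring.comul h) m n :=
  B.diag_mk π σ h m n

theorem Bialgebroid.comul_α (B : Bialgebroid k R H) (a : R) :
    B.coring.comul (B.α a) = B.self.tmul B.self (B.α a) 1 := by
  have h := B.coring.comul_l a 1
  simpa [B.comul_one] using h

theorem Bialgebroid.comul_β (B : Bialgebroid k R H) (a : Rᵐᵒᵖ) :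
    B.coring.comul (B.β a) = B.self.tmul B.self 1 (B.β a) := by
  have h := B.coring.comul_r a 1
  simpa [B.comul_one] using h

theorem Bialgebroid.tens_α (B : Bialgebroid k R H) (π : H →ₐ[k] Module.End k M)
    (σ : H →ₐ[k] Module.End k N) (a : R) (m : M) (n : N) :
    B.tens π σ (B.α a) (B.tmul π σ m n) = B.tmul π σ (π (B.α a) m) n := by
  simp [B.comul_α]

theorem Bialgebroid.tens_β (B : Bialgebroid k R H) (π : H →ₐ[k] Module.End k M)
    (σ : H →ₐ[k] Module.End k N) (a : Rᵐᵒᵖ) (m : M) (n : N) :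
    B.tens π σ (B.β a) (B.tmul π σ m n) = B.tmul π σ m (σ (B.β a) n) := by
  simp [B.comul_β]

theorem Bialgebroid.comul_mul_α (B : Bialgebroid k R H) (h : H) (a : R) :
    B.coring.comul (h * B.α a)
      = B.pair (Algebra.lmul k H) (Algebra.lmul k H) (B.coring.comul h) (B.α a) 1 := by
  rw [B.comul_mul, B.comul_α, B.diag_mk]

theorem Bialgebroid.comul_mul_β (B : Bialgebroid k R H) (h : H) (a : Rᵐᵒᵖ) :
    B.coring.comul (h * B.β a)
      = B.pair (Algebra.lmul k H) (Algebra.lmul k H) (B.coring.comul h) 1 (B.β a) := by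
  rw [B.comul_mul, B.comul_β, B.diag_mk]

theorem Bialgebroid.counit_α (B : Bialgebroid k R H) (a : R) : B.coring.counit (B.α a) = a := by
  have h := B.coring.counit_l a 1
  simpa [B.counit_one, Bimod.regular] using h

theorem Bialgebroid.counit_β (B : Bialgebroid k R H) (a : R) :
    B.coring.counit (B.β (MulOpposite.op a)) = a := by
  have h := B.coring.counit_r (MulOpposite.op a) 1
  simpa [B.counit_one, Bimod.regular] using h

/-- An antialgebra map `T : H → H` with `T β = α`. -/
structure Antipode (B : Bialgebroid k R H) where
  T : H →ₗ[k] H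
  T_mul : ∀ x y, T (x * y) = T y * T x
  T_one : T 1 = 1
  T_β : ∀ a : R, T (B.β (MulOpposite.op a)) = B.α a

/-- The map `m_H (T ⊗ id) : H ⊗_R H → H`, `x ⊗ y ↦ T(x) y`. -/
def Antipode.mulT {B : Bialgebroid k R H} (S : Antipode B) : B.HH →ₗ[k] H :=
  Bal.lift ((LinearMap.mul k H).comp S.T) (by
    intro a x y
    simp [S.T_mul, S.T_β, mul_assoc])

/-- The map `H ⊗_R H → H ⊗_R H`, `x ⊗ y ↦ T(x)⁽¹⁾ y ⊗ T(x)⁽²⁾`. -/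
def Antipode.twist {B : Bialgebroid k R H} (S : Antipode B) : B.HH →ₗ[k] B.HH :=
  Bal.lift (LinearMap.mk₂ k
      (fun x y : H => B.pair (Algebra.lmul k H) (Algebra.lmul k H) (B.coring.comul (S.T x)) y 1)
      (by intros; simp) (by intros; simp) (by intros; simp) (by intros; simp))
    (by
      intro a x y
      simp [S.T_mul, S.T_β, B.comul_mul_α, SrcTgt.pair_pair])

variable (k R H) in
/-- A para Hopf algebroid: a bialgebroid with a para-antipode `T`. -/
structure ParaHopfAlgebroid extends Bialgebroid k R H where
  antipode : Antipode toBialgebroid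
  /-- `m_H (T ⊗ id) Δ = β ε T` -/
  T_conv : ∀ h, antipode.mulT (coring.comul h) = β (MulOpposite.op (coring.counit (antipode.T h)))
  T_T : ∀ h, antipode.T (antipode.T h) = h
  /-- `T(h⁽¹⁾)⁽¹⁾ h⁽²⁾ ⊗ T(h⁽¹⁾)⁽²⁾ = 1 ⊗ T(h)` -/
  T_twist : ∀ h, antipode.twist (coring.comul h)
    = toSrcTgt.self.tmul toSrcTgt.self 1 (antipode.T h)

/-- The para-antipode. -/
abbrev ParaHopfAlgebroid.T (A : ParaHopfAlgebroid k R H) : H →ₗ[k] H := A.antipode.T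

theorem ParaHopfAlgebroid.T_α (A : ParaHopfAlgebroid k R H) (a : R) :
    A.T (A.α a) = A.β (MulOpposite.op a) := by
  rw [← A.antipode.T_β, A.T_T]

@[simp] theorem Antipode.mulT_mk {B : Bialgebroid k R H} (S : Antipode B) (x y : H) :
    S.mulT (B.self.tmul B.self x y) = S.T x * y := by
  rw [Antipode.mulT, Bal.lift_mk]
  rfl

@[simp] theorem Antipode.twist_mk {B : Bialgebroid k R H} (S : Antipode B) (x y : H) :
    S.twist (B.self.tmul B.self x y)
      = B.pair (Algebra.lmul k H) (Algebra.lmul k H) (B.coring.comul (S.T x)) y 1 := by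
  rw [Antipode.twist, Bal.lift_mk]
  rfl

theorem Antipode.mulT_pair {B : Bialgebroid k R H} (S : Antipode B) (t : B.HH) (x y : H) :
    S.mulT (B.pair (Algebra.lmul k H) (Algebra.lmul k H) t x y) = S.T x * S.mulT t * y := by
  induction t using Bal.ind with
  | h_mk p q => simp [S.T_mul, mul_assoc]
  | h_sum p q hp hq => simp only [map_add, LinearMap.add_apply, hp, hq, mul_add, add_mul]

theorem ParaHopfAlgebroid.β_counit (A : ParaHopfAlgebroid k R H) (h : H) :
    A.β (MulOpposite.op (A.coring.counit h)) = A.antipode.mulT (A.coring.comul (A.T h)) := by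
  rw [A.T_conv, A.T_T]

theorem ParaHopfAlgebroid.counit_mul (A : ParaHopfAlgebroid k R H) (g h : H) :
    A.coring.counit (g * h)
      = A.coring.counit (g * A.β (MulOpposite.op (A.coring.counit h))) := by
  have h1 : ∀ (x y : H), A.antipode.mulT (A.coring.comul x) = A.antipode.mulT (A.coring.comul y) →
      ∀ s : A.HH, A.antipode.mulT (A.diag (Algebra.lmul k H) (Algebra.lmul k H) x s)
        = A.antipode.mulT (A.diag (Algebra.lmul k H) (Algebra.lmul k H) y s) := by
    intro x y hxy s
    induction s using Bal.ind with
    | h_mk p q => rw [A.diag_mk, A.diag_mk, Antipode.mulT_pair, Antipode.mulT_pair, hxy]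
    | h_sum p q hp hq => simp only [map_add, hp, hq]
  have key : A.β (MulOpposite.op (A.coring.counit (g * h)))
      = A.β (MulOpposite.op
        (A.coring.counit (g * A.β (MulOpposite.op (A.coring.counit h))))) := by
    rw [A.β_counit (g * h), A.β_counit (g * A.β _), A.antipode.T_mul, A.antipode.T_mul,
      A.comul_mul, A.comul_mul]
    apply h1
    rw [A.antipode.T_β, A.comul_α, Antipode.mulT_mk, A.T_α, mul_one, ← A.β_counit]
  have e := congrArg A.coring.counit key
  rwa [A.counit_β, A.counit_β] at e

/-- The action `h · r = ε(h α(r))` of `H` on `R`. -/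
def ParaHopfAlgebroid.triv (A : ParaHopfAlgebroid k R H) : H →ₐ[k] Module.End k R :=
  AlgHom.ofLinearMap
    (LinearMap.mk₂ k (fun h r => A.coring.counit (h * A.α r))
      (by intros; simp [add_mul]) (by intros; simp) (by intros; simp [mul_add])
      (by intros; simp))
    (by ext r; simp [A.counit_α])
    (by
      intro g h
      ext r
      have e : A.coring.counit (g * (h * A.α r))
          = A.coring.counit (g * A.α (A.coring.counit (h * A.α r))) := by
        rw [A.counit_mul g, A.counit_mul g (A.α _), A.counit_α]
      simpa [mul_assoc] using e)

@[simp] theorem ParaHopfAlgebroid.triv_apply (A : ParaHopfAlgebroid k R H) (h : H) (r : R) :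
    A.triv h r = A.coring.counit (h * A.α r) := rfl

theorem ParaHopfAlgebroid.triv_β (A : ParaHopfAlgebroid k R H) (h : H) (r : R) :
    A.triv h r = A.coring.counit (h * A.β (MulOpposite.op r)) := by
  rw [A.triv_apply, A.counit_mul, A.counit_α]

end Bialgebroids

/-! ### Homomorphisms of `H`-modules -/

section Homs

variable {k R H M N P M₂ N₂ : Type*} [CommRing k] [Ring R] [Algebra k R] [Ring H] [Algebra k H]
  [AddCommGroup M] [Module k M] [AddCommGroup N] [Module k N] [AddCommGroup P] [Module k P]
  [AddCommGroup M₂] [Module k M₂] [AddCommGroup N₂] [Module k N₂]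

/-- `H`-linear maps. -/
structure HHom (π : H →ₐ[k] Module.End k M) (σ : H →ₐ[k] Module.End k N) where
  toLin : M →ₗ[k] N
  map_act : ∀ h m, toLin (π h m) = σ h (toLin m)

variable {π : H →ₐ[k] Module.End k M} {σ : H →ₐ[k] Module.End k N}
  {τ : H →ₐ[k] Module.End k P} {π₂ : H →ₐ[k] Module.End k M₂} {σ₂ : H →ₐ[k] Module.End k N₂}

def HHom.id (π : H →ₐ[k] Module.End k M) : HHom π π where
  toLin := LinearMap.id
  map_act _ _ := rfl

def HHom.comp (g : HHom σ τ) (f : HHom π σ) : HHom π τ where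
  toLin := g.toLin.comp f.toLin
  map_act h m := by simp [f.map_act, g.map_act]

/-- The linear map `f ⊗_R g`. -/
def Bialgebroid.mapLin (B : Bialgebroid k R H) (f : HHom π π₂) (g : HHom σ σ₂) :
    B.Ten π σ →ₗ[k] B.Ten π₂ σ₂ :=
  Bal.map f.toLin g.toLin (fun _ _ => f.map_act _ _) (fun _ _ => g.map_act _ _)

@[simp] theorem Bialgebroid.mapLin_mk (B : Bialgebroid k R H) (f : HHom π π₂) (g : HHom σ σ₂)
    (m : M) (n : N) :
    B.mapLin f g (B.tmul π σ m n) = B.tmul π₂ σ₂ (f.toLin m) (g.toLin n) :=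
  Bal.map_mk _ _ _ _ m n

theorem Bialgebroid.mapLin_pair (B : Bialgebroid k R H) (f : HHom π π₂) (g : HHom σ σ₂)
    (t : B.HH) (m : M) (n : N) :
    B.mapLin f g (B.pair π σ t m n) = B.pair π₂ σ₂ t (f.toLin m) (g.toLin n) := by
  induction t using Bal.ind with
  | h_mk p q => simp [f.map_act, g.map_act]
  | h_sum x y hx hy => simp only [map_add, LinearMap.add_apply, hx, hy]

/-- The `H`-linear map `f ⊗_R g`. -/
def Bialgebroid.map (B : Bialgebroid k R H) (f : HHom π π₂) (g : HHom σ σ₂) :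
    HHom (B.tens π σ) (B.tens π₂ σ₂) where
  toLin := B.mapLin f g
  map_act h z := by
    induction z using Bal.ind with
    | h_mk m n => rw [B.tens_mk, B.mapLin_pair, B.mapLin_mk, B.tens_mk]
    | h_sum x y hx hy => simp only [map_add, hx, hy]

/-- The map `x ⊗ (y ⊗ z) ↦ x m ⊗ (y n ⊗ z p)`. -/
def Bialgebroid.triple (B : Bialgebroid k R H) (π : H →ₐ[k] Module.End k M)
    (σ : H →ₐ[k] Module.End k N) (τ : H →ₐ[k] Module.End k P) (m : M) (n : N) (p : P) :
    B.self.Ten (B.self.tensor B.self) →ₗ[k] B.Ten π (B.tens σ τ) :=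
  Bal.map (π.toLinearMap.flip m) (((B.pair σ τ).flip n).flip p)
    (by intro a x; simp)
    (by
      intro a s
      induction s using Bal.ind with
      | h_mk x y =>
        rw [Bimod.tensor_l]
        simp [B.tens_α]
      | h_sum x y hx hy => simp only [map_add, hx, hy])

theorem Bialgebroid.triple_mk (B : Bialgebroid k R H) (m : M) (n : N) (p : P) (x : H) (s : B.HH) :
    B.triple π σ τ m n p (B.self.tmul (B.self.tensor B.self) x s)
      = B.tmul π (B.tens σ τ) (π x m) (B.pair σ τ s n p) :=
  Bal.map_mk _ _ _ _ x s

/-- The linear map `(m ⊗ n) ⊗ p ↦ m ⊗ (n ⊗ p)`. -/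
def Bialgebroid.assocLin (B : Bialgebroid k R H) (π : H →ₐ[k] Module.End k M)
    (σ : H →ₐ[k] Module.End k N) (τ : H →ₐ[k] Module.End k P) :
    B.Ten (B.tens π σ) τ →ₗ[k] B.Ten π (B.tens σ τ) :=
  Bal.assoc _ _ (fun _ m n => B.tens_β π σ _ m n) (fun _ m n => B.tens_α σ τ _ m n)

@[simp] theorem Bialgebroid.assocLin_mk (B : Bialgebroid k R H) (π : H →ₐ[k] Module.End k M)
    (σ : H →ₐ[k] Module.End k N) (τ : H →ₐ[k] Module.End k P) (m : M) (n : N) (p : P) :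
    B.assocLin π σ τ (B.tmul (B.tens π σ) τ (B.tmul π σ m n) p)
      = B.tmul π (B.tens σ τ) m (B.tmul σ τ n p) :=
  Bal.assoc_mk _ _ _ _ m n p

/-- The linear map `m ⊗ (n ⊗ p) ↦ (m ⊗ n) ⊗ p`. -/
def Bialgebroid.assocInv (B : Bialgebroid k R H) (π : H →ₐ[k] Module.End k M)
    (σ : H →ₐ[k] Module.End k N) (τ : H →ₐ[k] Module.End k P) :
    B.Ten π (B.tens σ τ) →ₗ[k] B.Ten (B.tens π σ) τ :=
  Bal.assocInv _ _ (fun _ m n => B.tens_β π σ _ m n) (fun _ m n => B.tens_α σ τ _ m n)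

@[simp] theorem Bialgebroid.assocInv_mk (B : Bialgebroid k R H) (π : H →ₐ[k] Module.End k M)
    (σ : H →ₐ[k] Module.End k N) (τ : H →ₐ[k] Module.End k P) (m : M) (n : N) (p : P) :
    B.assocInv π σ τ (B.tmul π (B.tens σ τ) m (B.tmul σ τ n p))
      = B.tmul (B.tens π σ) τ (B.tmul π σ m n) p :=
  Bal.assocInv_mk _ _ _ _ m n p

theorem Bialgebroid.assoc_pair_left (B : Bialgebroid k R H) (t : B.HH) (m : M) (n : N) (p : P) :
    B.assocLin π σ τ (B.pair (B.tens π σ) τ t (B.tmul π σ m n) p)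
      = B.triple π σ τ m n p (B.self.assoc
          ((Bal.map B.coring.comul LinearMap.id (fun _ => B.coring.comul_r _) (fun _ _ => rfl) :
            B.self.Ten B.self →ₗ[k] (B.self.tensor B.self).Ten B.self) t)) := by
  induction t using Bal.ind with
  | h_mk x y =>
    rw [SrcTgt.pair_mk, B.tens_mk, Bal.map_mk]
    generalize B.coring.comul x = s
    induction s using Bal.ind with
    | h_mk q r =>
      rw [SrcTgt.pair_mk, B.assocLin_mk, Bimod.assoc, Bal.assoc_mk, B.triple_mk, SrcTgt.pair_mk]
      rfl
    | h_sum q r hq hr => simp only [map_add, LinearMap.add_apply, hq, hr]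
  | h_sum x y hx hy => simp only [map_add, LinearMap.add_apply, hx, hy]

theorem Bialgebroid.assoc_pair_right (B : Bialgebroid k R H) (t : B.HH) (m : M) (n : N) (p : P) :
    B.pair π (B.tens σ τ) t m (B.tmul σ τ n p)
      = B.triple π σ τ m n p
          ((Bal.map LinearMap.id B.coring.comul (fun _ _ => rfl) B.coring.comul_l :
            B.self.Ten B.self →ₗ[k] B.self.Ten (B.self.tensor B.self)) t) := by
  induction t using Bal.ind with
  | h_mk x y =>
    rw [SrcTgt.pair_mk, B.tens_mk, Bal.map_mk, B.triple_mk]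
    rfl
  | h_sum x y hx hy => simp only [map_add, LinearMap.add_apply, hx, hy]

/-- The `H`-linear map `(m ⊗ n) ⊗ p ↦ m ⊗ (n ⊗ p)`. -/
def Bialgebroid.assoc (B : Bialgebroid k R H) (π : H →ₐ[k] Module.End k M)
    (σ : H →ₐ[k] Module.End k N) (τ : H →ₐ[k] Module.End k P) :
    HHom (B.tens (B.tens π σ) τ) (B.tens π (B.tens σ τ)) where
  toLin := B.assocLin π σ τ
  map_act h z := by
    induction z using Bal.ind with
    | h_mk w p =>
      induction w using Bal.ind with
      | h_mk m n =>
        rw [B.tens_mk, B.assoc_pair_left, ← B.coring.coassoc, ← B.assoc_pair_right, B.assocLin_mk,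
          B.tens_mk]
      | h_sum x y hx hy => simp only [map_add, LinearMap.add_apply, hx, hy]
    | h_sum x y hx hy => simp only [map_add, hx, hy]

/-- The map `M ⊗_R R → M`, `m ⊗ r ↦ β(r) m`. -/
def ParaHopfAlgebroid.runit (A : ParaHopfAlgebroid k R H) (π : H →ₐ[k] Module.End k M) :
    A.Ten π A.triv →ₗ[k] M :=
  Bal.lift (LinearMap.mk₂ k (fun m r => π (A.β (MulOpposite.op r)) m)
    (by intros; simp) (by intros; simp) (by intros; simp) (by intros; simp))
    (by
      intro a m r
      have e : A.coring.counit (A.α a * A.α r) = a * r := by rw [← map_mul, A.counit_α]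
      simp [e])

/-- The map `R ⊗_R M → M`, `r ⊗ m ↦ α(r) m`. -/
def ParaHopfAlgebroid.lunit (A : ParaHopfAlgebroid k R H) (π : H →ₐ[k] Module.End k M) :
    A.Ten A.triv π →ₗ[k] M :=
  Bal.lift (LinearMap.mk₂ k (fun r m => π (A.α r) m)
    (by intros; simp) (by intros; simp) (by intros; simp) (by intros; simp))
    (by
      intro a r m
      have e : A.coring.counit (A.β (MulOpposite.op a) * A.α r) = r * a := by
        rw [A.counit_mul, A.counit_α, ← map_mul, ← MulOpposite.op_mul, A.counit_β]
      simp [e])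

@[simp] theorem ParaHopfAlgebroid.runit_mk (A : ParaHopfAlgebroid k R H) (m : M) (r : R) :
    A.runit π (A.tmul π A.triv m r) = π (A.β (MulOpposite.op r)) m :=
  Bal.lift_mk _ _ m r

@[simp] theorem ParaHopfAlgebroid.lunit_mk (A : ParaHopfAlgebroid k R H) (r : R) (m : M) :
    A.lunit π (A.tmul A.triv π r m) = π (A.α r) m :=
  Bal.lift_mk _ _ r m

theorem ParaHopfAlgebroid.counit_id_pair (A : ParaHopfAlgebroid k R H) (h : H) (r : R) (m : M) :
    A.lunit π (A.pair A.triv π (A.coring.comul h) r m) = π (h * A.α r) m := by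
  have h1 : ∀ t : A.HH, A.lunit π (A.pair A.triv π t 1 m)
      = π (A.self.lunit ((Bal.map A.coring.counit LinearMap.id (fun _ => A.coring.counit_r _)
        (fun _ _ => rfl) : A.self.Ten A.self →ₗ[k] (Bimod.regular k R).Ten A.self) t)) m := by
    intro t
    induction t using Bal.ind with
    | h_mk x y =>
      rw [SrcTgt.pair_mk, A.lunit_mk, Bal.map_mk, Bimod.lunit_mk]
      simp
    | h_sum x y hx hy => simp only [map_add, LinearMap.add_apply, hx, hy]
  have h2 := h1 (A.coring.comul (h * A.α r))
  rw [A.coring.counit_id, A.comul_mul_α, A.pair_pair] at h2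
  simpa [A.counit_α] using h2

theorem ParaHopfAlgebroid.id_counit_pair (A : ParaHopfAlgebroid k R H) (h : H) (m : M) :
    A.pair π A.triv (A.coring.comul h) m 1 = A.tmul π A.triv (π h m) 1 := by
  have h1 : ∀ t : A.HH, A.pair π A.triv t m 1
      = A.tmul π A.triv (π (A.self.runit ((Bal.map LinearMap.id A.coring.counit (fun _ _ => rfl)
        A.coring.counit_l : A.self.Ten A.self →ₗ[k] A.self.Ten (Bimod.regular k R)) t)) m) 1 := by
    intro t
    induction t using Bal.ind with
    | h_mk x y =>
      rw [SrcTgt.pair_mk, Bal.map_mk, Bimod.runit_mk]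
      have e := A.tmul_bal π A.triv (A.coring.counit y) (π x m) 1
      simp only [A.triv_apply, map_one, mul_one, A.counit_α] at e
      simp [e]
    | h_sum x y hx hy => simp only [map_add, LinearMap.add_apply, hx, hy]
  rw [h1, A.coring.id_counit]

/-- The `H`-linear map `R ⊗_R M → M ⊗_R R`, `r ⊗ m ↦ r m ⊗ 1`. -/
def ParaHopfAlgebroid.swapUnit (A : ParaHopfAlgebroid k R H) (π : H →ₐ[k] Module.End k M) :
    HHom (A.tens A.triv π) (A.tens π A.triv) where
  toLin := ((A.tmul π A.triv).flip 1).comp (A.lunit π)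
  map_act h z := by
    induction z using Bal.ind with
    | h_mk r m =>
      simp only [LinearMap.comp_apply, LinearMap.flip_apply]
      rw [A.tens_mk, A.counit_id_pair, A.lunit_mk, A.tens_mk, A.id_counit_pair, map_mul]
      rfl
    | h_sum x y hx hy => simp only [map_add, hx, hy]

/-! ### Tensor products over `H` -/

/-- `M ⊗_H N`, where the left `H`-module `M` is a right `H`-module by `m h = T(h) m`. -/
abbrev ParaHopfAlgebroid.HTen (A : ParaHopfAlgebroid k R H) (π : H →ₐ[k] Module.End k M)
    (σ : H →ₐ[k] Module.End k N) : Type _ :=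
  Bal (fun h : H => π (A.T h)) (fun h : H => σ h)

/-- The element `m ⊗_H n`. -/
abbrev ParaHopfAlgebroid.htmul (A : ParaHopfAlgebroid k R H) (π : H →ₐ[k] Module.End k M)
    (σ : H →ₐ[k] Module.End k N) : M →ₗ[k] N →ₗ[k] A.HTen π σ :=
  Bal.mk (fun h : H => π (A.T h)) (fun h : H => σ h)

theorem ParaHopfAlgebroid.htmul_bal (A : ParaHopfAlgebroid k R H) (π : H →ₐ[k] Module.End k M)
    (σ : H →ₐ[k] Module.End k N) (h : H) (m : M) (n : N) :
    A.htmul π σ (π h m) n = A.htmul π σ m (σ (A.T h) n) := by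
  have e := Bal.mk_bal (ρ := fun h : H => π (A.T h)) (l := fun h : H => σ h) (A.T h) m n
  simpa only [A.T_T] using e

/-- The map `f ⊗_H g`. -/
def ParaHopfAlgebroid.hmap (A : ParaHopfAlgebroid k R H) (f : HHom π π₂) (g : HHom σ σ₂) :
    A.HTen π σ →ₗ[k] A.HTen π₂ σ₂ :=
  Bal.map f.toLin g.toLin (fun _ _ => f.map_act _ _) (fun _ _ => g.map_act _ _)

@[simp] theorem ParaHopfAlgebroid.hmap_mk (A : ParaHopfAlgebroid k R H) (f : HHom π π₂)
    (g : HHom σ σ₂) (m : M) (n : N) :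
    A.hmap f g (A.htmul π σ m n) = A.htmul π₂ σ₂ (f.toLin m) (g.toLin n) :=
  Bal.map_mk _ _ _ _ m n

/-- The map `(m ⊗_R n, p) ↦ m ⊗_H (n ⊗_R p)`. -/
def ParaHopfAlgebroid.hassocAux (A : ParaHopfAlgebroid k R H) (π : H →ₐ[k] Module.End k M)
    (σ : H →ₐ[k] Module.End k N) (τ : H →ₐ[k] Module.End k P) :
    A.Ten π σ →ₗ[k] P →ₗ[k] A.HTen π (A.tens σ τ) :=
  Bal.lift (LinearMap.mk₂ k (fun m n => (A.htmul π (A.tens σ τ) m).comp (A.tmul σ τ n))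
      (by intros; ext; simp) (by intros; ext; simp) (by intros; ext; simp)
      (by intros; ext; simp))
    (by
      intro a m n
      ext p
      have e := A.htmul_bal π (A.tens σ τ) (A.β (MulOpposite.op a)) m (A.tmul σ τ n p)
      rw [A.antipode.T_β, A.tens_α] at e
      simpa using e)

@[simp] theorem ParaHopfAlgebroid.hassocAux_mk (A : ParaHopfAlgebroid k R H)
    (m : M) (n : N) (p : P) :
    A.hassocAux π σ τ (A.tmul π σ m n) p = A.htmul π (A.tens σ τ) m (A.tmul σ τ n p) := by
  rw [ParaHopfAlgebroid.hassocAux, Bal.lift_mk]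
  rfl

theorem ParaHopfAlgebroid.hassocAux_pair (A : ParaHopfAlgebroid k R H) (t : A.HH)
    (m : M) (n : N) (p : P) :
    A.hassocAux π σ τ (A.pair π σ t m n) p
      = A.htmul π (A.tens σ τ) m (A.pair σ τ (A.antipode.twist t) n p) := by
  induction t using Bal.ind with
  | h_mk x y =>
    rw [SrcTgt.pair_mk, A.hassocAux_mk, Antipode.twist_mk, A.pair_pair, A.htmul_bal, A.tens_mk]
    simp
  | h_sum x y hx hy => simp only [map_add, LinearMap.add_apply, hx, hy]

theorem ParaHopfAlgebroid.hassocAux_bal (A : ParaHopfAlgebroid k R H) (h : H) (z : A.Ten π σ)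
    (p : P) :
    A.hassocAux π σ τ (A.tens π σ (A.T h) z) p = A.hassocAux π σ τ z (τ h p) := by
  induction z using Bal.ind with
  | h_mk m n =>
    rw [A.tens_mk, A.hassocAux_pair, A.T_twist, A.T_T, SrcTgt.pair_mk, A.hassocAux_mk, map_one]
    rfl
  | h_sum x y hx hy => simp only [map_add, LinearMap.add_apply, hx, hy]

/-- The map `(M ⊗_R N) ⊗_H P → M ⊗_H (N ⊗_R P)`, `(m ⊗ n) ⊗ p ↦ m ⊗ (n ⊗ p)`. -/
def ParaHopfAlgebroid.hassoc (A : ParaHopfAlgebroid k R H) (π : H →ₐ[k] Module.End k M)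
    (σ : H →ₐ[k] Module.End k N) (τ : H →ₐ[k] Module.End k P) :
    A.HTen (A.tens π σ) τ →ₗ[k] A.HTen π (A.tens σ τ) :=
  Bal.lift (A.hassocAux π σ τ) A.hassocAux_bal

@[simp] theorem ParaHopfAlgebroid.hassoc_mk (A : ParaHopfAlgebroid k R H) (m : M) (n : N) (p : P) :
    A.hassoc π σ τ (A.htmul (A.tens π σ) τ (A.tmul π σ m n) p)
      = A.htmul π (A.tens σ τ) m (A.tmul σ τ n p) := by
  rw [ParaHopfAlgebroid.hassoc, Bal.lift_mk, A.hassocAux_mk]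

/-- The map `N ⊗_R P → N ⊗_H (P ⊗_R M)`, `n ⊗ p ↦ n ⊗ (p ⊗ m)`, for `m ∈ M`. -/
def ParaHopfAlgebroid.rotAux (A : ParaHopfAlgebroid k R H) (π : H →ₐ[k] Module.End k M)
    (σ : H →ₐ[k] Module.End k N) (τ : H →ₐ[k] Module.End k P) (m : M) :
    A.Ten σ τ →ₗ[k] A.HTen σ (A.tens τ π) :=
  Bal.lift ((A.htmul σ (A.tens τ π)).compl₁₂ LinearMap.id ((A.tmul τ π).flip m))
    (by
      intro a n p
      have e := A.htmul_bal σ (A.tens τ π) (A.β (MulOpposite.op a)) n (A.tmul τ π p m)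
      rw [A.antipode.T_β, A.tens_α] at e
      simpa using e)

@[simp] theorem ParaHopfAlgebroid.rotAux_mk (A : ParaHopfAlgebroid k R H) (m : M) (n : N) (p : P) :
    A.rotAux π σ τ m (A.tmul σ τ n p) = A.htmul σ (A.tens τ π) n (A.tmul τ π p m) := by
  rw [ParaHopfAlgebroid.rotAux, Bal.lift_mk]
  rfl

theorem ParaHopfAlgebroid.rotAux_pair (A : ParaHopfAlgebroid k R H) (t : A.HH)
    (m : M) (n : N) (p : P) :
    A.rotAux π σ τ m (A.pair σ τ t n p)
      = A.htmul σ (A.tens τ π) n (A.pair τ π (A.antipode.twist t) p m) := by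
  induction t using Bal.ind with
  | h_mk x y =>
    rw [SrcTgt.pair_mk, A.rotAux_mk, Antipode.twist_mk, A.pair_pair, A.htmul_bal, A.tens_mk]
    simp
  | h_sum x y hx hy => simp only [map_add, LinearMap.add_apply, hx, hy]

theorem ParaHopfAlgebroid.rotAux_bal (A : ParaHopfAlgebroid k R H) (h : H) (m : M)
    (z : A.Ten σ τ) :
    A.rotAux π σ τ (π (A.T h) m) z = A.rotAux π σ τ m (A.tens σ τ h z) := by
  induction z using Bal.ind with
  | h_mk n p =>
    rw [A.tens_mk, A.rotAux_pair, A.rotAux_mk, A.T_twist, SrcTgt.pair_mk, map_one]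
    rfl
  | h_sum x y hx hy => simp only [map_add, hx, hy]

/-- The map `M ⊗_H (N ⊗_R P) → N ⊗_H (P ⊗_R M)`, `m ⊗ (n ⊗ p) ↦ n ⊗ (p ⊗ m)`. -/
def ParaHopfAlgebroid.rot (A : ParaHopfAlgebroid k R H) (π : H →ₐ[k] Module.End k M)
    (σ : H →ₐ[k] Module.End k N) (τ : H →ₐ[k] Module.End k P) :
    A.HTen π (A.tens σ τ) →ₗ[k] A.HTen σ (A.tens τ π) :=
  Bal.lift
    { toFun := A.rotAux π σ τ
      map_add' := fun m m' => Bal.hom_ext fun n p => by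
        simp only [A.rotAux_mk, LinearMap.add_apply, map_add]
      map_smul' := fun c m => Bal.hom_ext fun n p => by
        simp only [A.rotAux_mk, LinearMap.smul_apply, map_smul, RingHom.id_apply] }
    A.rotAux_bal

@[simp] theorem ParaHopfAlgebroid.rot_mk (A : ParaHopfAlgebroid k R H) (m : M) (n : N) (p : P) :
    A.rot π σ τ (A.htmul π (A.tens σ τ) m (A.tmul σ τ n p))
      = A.htmul σ (A.tens τ π) n (A.tmul τ π p m) := by
  rw [ParaHopfAlgebroid.rot, Bal.lift_mk]
  exact A.rotAux_mk m n p

end Homs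

/-! ### Module corings and coseparability -/

section ModuleCorings

variable {k R H C : Type*} [CommRing k] [Ring R] [Algebra k R] [Ring H] [Algebra k H]
  [AddCommGroup C] [Module k C]

/-- An `H`-module coring: a coring over `R` on the `H`-module `C`, whose left and right actions of
`R` are the ones induced by `α` and `β`, such that `Δ` and `ε` are `H`-linear. -/
structure ModuleCoring (A : ParaHopfAlgebroid k R H) (π : H →ₐ[k] Module.End k C) where
  coring : Coring (A.bimod π)
  comul_act : ∀ h c, coring.comul (π h c) = A.tens π π h (coring.comul c)
  counit_act : ∀ h c, coring.counit (π h c) = A.triv h (coring.counit c)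

variable {A : ParaHopfAlgebroid k R H} {π : H →ₐ[k] Module.End k C}

/-- `Δ : C → C ⊗_R C` as an `H`-linear map. -/
def ModuleCoring.Δ (K : ModuleCoring A π) : HHom π (A.tens π π) := ⟨K.coring.comul, K.comul_act⟩

/-- `ε : C → R` as an `H`-linear map. -/
def ModuleCoring.ε (K : ModuleCoring A π) : HHom π A.triv := ⟨K.coring.counit, K.counit_act⟩

/-- `H`-coseparability: there is an `H`-linear `δ : C ⊗_R C → R` with `δ Δ = ε` and
`(id ⊗ δ)(Δ ⊗ id) = (δ ⊗ id)(id ⊗ Δ)` as maps `C ⊗_R C → C`. -/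
def ModuleCoring.IsCoseparable (K : ModuleCoring A π) : Prop :=
  ∃ δ : HHom (A.tens π π) A.triv,
    (∀ c, δ.toLin (K.Δ.toLin c) = K.ε.toLin c) ∧
    ∀ z : A.Ten π π,
      A.runit π (A.mapLin (HHom.id π) δ (A.assocLin π π π (A.mapLin K.Δ (HHom.id π) z)))
        = A.lunit π (A.mapLin δ (HHom.id π) (A.assocInv π π π (A.mapLin (HHom.id π) K.Δ z)))

end ModuleCorings

/-! ### Cyclic cohomology from cofaces and cyclic operators -/

section Cyclic

/-- The cofaces and the cyclic operators of a cocyclic `k`-module (the codegeneracies do not enter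
the cyclic bicomplex). -/
structure CocyclicData (k : Type*) [CommRing k] where
  X : ℕ → Type v
  [grp : ∀ n, AddCommGroup (X n)]
  [mod : ∀ n, Module k (X n)]
  /-- `δ_i : X^n → X^{n+1}`, `0 ≤ i ≤ n + 1` -/
  coface : ∀ n, Fin (n + 2) → X n →ₗ[k] X (n + 1)
  /-- `τ : X^n → X^n` -/
  cyc : ∀ n, X n →ₗ[k] X n

attribute [instance] CocyclicData.grp CocyclicData.mod

variable {k : Type*} [CommRing k] (Z : CocyclicData.{v} k)

/-- The Hochschild coboundary `b = ∑_{i=0}^{n+1} (-1)^i δ_i`. -/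
def CocyclicData.b (n : ℕ) : Z.X n →ₗ[k] Z.X (n + 1) :=
  ∑ i : Fin (n + 2), (-1 : k) ^ (i : ℕ) • Z.coface n i

/-- `b' = ∑_{i=0}^{n} (-1)^i δ_i`. -/
def CocyclicData.b' (n : ℕ) : Z.X n →ₗ[k] Z.X (n + 1) :=
  ∑ i : Fin (n + 1), (-1 : k) ^ (i : ℕ) • Z.coface n i.castSucc

/-- The signed cyclic operator `λ = (-1)^n τ`. -/
def CocyclicData.signedCyc (n : ℕ) : Module.End k (Z.X n) := (-1 : k) ^ n • Z.cyc n

/-- The norm operator `N = 1 + λ + ⋯ + λ^n`. -/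
def CocyclicData.norm (n : ℕ) : Module.End k (Z.X n) :=
  ∑ i ∈ Finset.range (n + 1), Z.signedCyc n ^ i

/-- Vertical differentials of the cyclic bicomplex: `b` in even columns, `-b'` in odd ones. -/
def CocyclicData.vert (p q : ℕ) : Z.X q →ₗ[k] Z.X (q + 1) :=
  if Even p then Z.b q else -Z.b' q

/-- Horizontal differentials of the cyclic bicomplex, from column `p` to column `p + 1`: `1 - λ`
from even columns, `N` from odd ones. -/
def CocyclicData.horiz (p q : ℕ) : Module.End k (Z.X q) :=
  if Even p then 1 - Z.signedCyc q else Z.norm q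

/-- Degree `n` of the total complex of the cyclic bicomplex, `⨁_{p+q=n} X^q`: the families whose
component `x q` (in column `p = n - q`) vanishes for `q > n`. -/
def CocyclicData.tot (n : ℕ) : Submodule k (∀ q, Z.X q) where
  carrier := {x | ∀ q, n < q → x q = 0}
  zero_mem' _ _ := rfl
  add_mem' hx hy q hq := by simp [hx q hq, hy q hq]
  smul_mem' c x hx q hq := by simp [hx q hq]

/-- The component in `X^q` of the total differential from degree `n` to degree `n + 1`. -/
def CocyclicData.dComp (n : ℕ) : ∀ q, (∀ j, Z.X j) →ₗ[k] Z.X q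
  | 0 => Z.horiz n 0 ∘ₗ LinearMap.proj 0
  | q + 1 => Z.vert (n - q) q ∘ₗ LinearMap.proj q
      + Z.horiz (n - (q + 1)) (q + 1) ∘ₗ LinearMap.proj (q + 1)

/-- The total differential (to be applied to families in `tot n`). -/
def CocyclicData.d (n : ℕ) : (∀ q, Z.X q) →ₗ[k] (∀ q, Z.X q) :=
  LinearMap.pi (Z.dComp n)

/-- The cocycles of degree `n` of the total complex. -/
def CocyclicData.cocycles (n : ℕ) : Submodule k (∀ q, Z.X q) := Z.tot n ⊓ LinearMap.ker (Z.d n)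

/-- The coboundaries of degree `n` of the total complex. -/
def CocyclicData.coboundaries : ℕ → Submodule k (∀ q, Z.X q)
  | 0 => ⊥
  | n + 1 => (Z.tot n).map (Z.d n)

/-- The cyclic cohomology `HC^n`: the cohomology of the total complex of the cyclic bicomplex. -/
abbrev CocyclicData.HC (n : ℕ) : Type _ :=
  Z.cocycles n ⧸ (Z.coboundaries n).submoduleOf (Z.cocycles n)

end Cyclic

/-! ### The Hopf-cyclic cohomology of a module coring -/

section HopfCyclicCohomology

/-- A (bundled) module over the `k`-algebra `H`. -/
structure LMod (k H : Type*) [CommRing k] [Ring H] [Algebra k H] where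
  carrier : Type v
  [grp : AddCommGroup carrier]
  [mod : Module k carrier]
  act : H →ₐ[k] Module.End k carrier

attribute [instance] LMod.grp LMod.mod

variable {k H : Type*} {R C : Type v} [CommRing k] [Ring R] [Algebra k R] [Ring H] [Algebra k H]
  [AddCommGroup C] [Module k C]
  {A : ParaHopfAlgebroid k R H} {π : H →ₐ[k] Module.End k C} (K : ModuleCoring A π)

variable (A π) in
/-- The `H`-module `C ⊗_R ⋯ ⊗_R C` (`n` factors, diagonal action), in the form
`C ⊗_R (C ⊗_R (⋯ (C ⊗_R R)))`; it is `R` for `n = 0`. -/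
def ParaHopfAlgebroid.pow : ℕ → LMod.{v} k H
  | 0 => { carrier := R, act := A.triv }
  | n + 1 => { carrier := A.Ten π (ParaHopfAlgebroid.pow n).act,
               act := A.tens π (ParaHopfAlgebroid.pow n).act }

/-- The `H`-linear map `C^{⊗ n} → C^{⊗ (n+1)}` that applies `Δ` to the factor number `j`
(counted from `0`). -/
def ModuleCoring.comulAt : (n : ℕ) → Fin n → HHom (A.pow π n).act (A.pow π (n + 1)).act
  | n + 1, j => Fin.cases
      ((A.assoc π π (A.pow π n).act).comp (A.map K.Δ (HHom.id _)))
      (fun i => A.map (HHom.id π) (ModuleCoring.comulAt n i)) j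

variable (A π) in
/-- The `H`-linear map `C^{⊗ n} ⊗_R C → C^{⊗ (n+1)}`,
`(c₁ ⊗ ⋯ ⊗ cₙ) ⊗ c ↦ c₁ ⊗ ⋯ ⊗ cₙ ⊗ c`. -/
def ParaHopfAlgebroid.append : (n : ℕ) →
    HHom (A.tens (A.pow π n).act π) (A.pow π (n + 1)).act
  | 0 => A.swapUnit π
  | n + 1 => (A.map (HHom.id π) (ParaHopfAlgebroid.append n)).comp (A.assoc π (A.pow π n).act π)

variable (A π) in
/-- `C^n = C ⊗_H C^{⊗_R n}`. -/
abbrev ParaHopfAlgebroid.cochain (n : ℕ) : Type v := A.HTen π (A.pow π n).act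

variable (A π) in
/-- `τ(c₀ ⊗_H c₁ ⊗ ⋯ ⊗ cₙ) = c₁ ⊗_H c₂ ⊗ ⋯ ⊗ cₙ ⊗ c₀`, and `τ = id` on `C^0`. -/
def ParaHopfAlgebroid.tau : (n : ℕ) → A.cochain π n →ₗ[k] A.cochain π n
  | 0 => LinearMap.id
  | n + 1 => (A.hmap (HHom.id π) (A.append π n)).comp (A.rot π π (A.pow π n).act)

theorem ParaHopfAlgebroid.append_zero_mk (r : R) (c : C) :
    (A.append π 0).toLin (A.tmul A.triv π r c) = A.tmul π A.triv (π (A.α r) c) 1 :=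
  congrArg (fun x => A.tmul π A.triv x 1) (A.lunit_mk (π := π) r c)

theorem ParaHopfAlgebroid.append_succ_mk (n : ℕ) (c d : C) (y : (A.pow π n).carrier) :
    (A.append π (n + 1)).toLin
        (A.tmul (A.tens π (A.pow π n).act) π (A.tmul π (A.pow π n).act c y) d)
      = A.tmul π (A.pow π (n + 1)).act c
          ((A.append π n).toLin (A.tmul (A.pow π n).act π y d)) :=
  (congrArg _ (A.assocLin_mk π (A.pow π n).act π c y d)).trans (A.mapLin_mk _ _ _ _)

theorem ParaHopfAlgebroid.tau_mk (n : ℕ) (c d : C) (y : (A.pow π n).carrier) :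
    A.tau π (n + 1) (A.htmul π (A.tens π (A.pow π n).act) c (A.tmul π (A.pow π n).act d y))
      = A.htmul π (A.pow π (n + 1)).act d
          ((A.append π n).toLin (A.tmul (A.pow π n).act π y c)) :=
  (congrArg (A.hmap (HHom.id π) (A.append π n)) (A.rot_mk c d y)).trans (A.hmap_mk _ _ _ _)

theorem ModuleCoring.comulAt_zero_mk (n : ℕ) (c : C) (y : (A.pow π n).carrier) :
    (K.comulAt (n + 1) 0).toLin (A.tmul π (A.pow π n).act c y)
      = A.assocLin π π (A.pow π n).act
          (A.tmul (A.tens π π) (A.pow π n).act (K.coring.comul c) y) :=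
  congrArg (A.assocLin π π (A.pow π n).act) (A.mapLin_mk K.Δ (HHom.id (A.pow π n).act) c y)

theorem ModuleCoring.comulAt_succ_mk (n : ℕ) (i : Fin n) (c : C) (y : (A.pow π n).carrier) :
    (K.comulAt (n + 1) i.succ).toLin (A.tmul π (A.pow π n).act c y)
      = A.tmul π (A.pow π (n + 1)).act c ((K.comulAt n i).toLin y) :=
  A.mapLin_mk _ _ _ _

/-- `δ_0(c₀ ⊗_H y) = c₀⁽¹⁾ ⊗_H (c₀⁽²⁾ ⊗_R y)`. -/
def ModuleCoring.cofaceZero (n : ℕ) : A.cochain π n →ₗ[k] A.cochain π (n + 1) :=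
  (A.hassoc π π (A.pow π n).act).comp (A.hmap K.Δ (HHom.id _))

/-- The cofaces `δ_i`. For `1 ≤ i ≤ n` they apply `Δ` to `c_i`, and
`δ_{n+1}(c₀ ⊗_H c₁ ⊗ ⋯ ⊗ cₙ) = c₀⁽²⁾ ⊗_H c₁ ⊗ ⋯ ⊗ cₙ ⊗ c₀⁽¹⁾` is `τ δ_0`. -/
def ModuleCoring.coface (n : ℕ) (i : Fin (n + 2)) : A.cochain π n →ₗ[k] A.cochain π (n + 1) :=
  Fin.cases (K.cofaceZero n)
    (fun j => Fin.lastCases ((A.tau π (n + 1)).comp (K.cofaceZero n))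
      (fun j => A.hmap (HHom.id π) (K.comulAt n j)) j) i

theorem ModuleCoring.coface_zero_mk (n : ℕ) (c : C) (y : (A.pow π n).carrier) :
    K.coface n 0 (A.htmul π (A.pow π n).act c y)
      = A.hassocAux π π (A.pow π n).act (K.coring.comul c) y :=
  (congrArg _ (A.hmap_mk _ _ _ _)).trans (Bal.lift_mk _ _ _ _)

theorem ModuleCoring.coface_mid (n : ℕ) (j : Fin n) :
    K.coface n j.castSucc.succ = A.hmap (HHom.id π) (K.comulAt n j) := by
  unfold ModuleCoring.coface
  rw [Fin.cases_succ, Fin.lastCases_castSucc]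

theorem ModuleCoring.coface_last (n : ℕ) :
    K.coface n (Fin.last (n + 1)) = (A.tau π (n + 1)).comp (K.coface n 0) := by
  unfold ModuleCoring.coface
  rw [← Fin.succ_last, Fin.cases_succ, Fin.lastCases_last, Fin.cases_zero]

/-- The cofaces and cyclic operators of the cocyclic module of an `H`-module coring. -/
def ModuleCoring.cocyclic : CocyclicData.{v} k where
  X := A.cochain π
  coface := K.coface
  cyc := A.tau π

/-- The Hopf-cyclic cohomology `HC_H^n(C, R)`. -/
abbrev ModuleCoring.HC (n : ℕ) : Type _ := K.cocyclic.HC n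

end HopfCyclicCohomology

end HopfCyclic

end

noncomputable section

namespace HopfCyclic

/-! Coseparability makes every column of the cyclic bicomplex exact in positive rows, so the total
cohomology can be read off in row 0.

The source of exactness is `retraction`: for a coseparability map δ, the `H`-linear map φ = (id ⊗
δ)(Δ ⊗ id) = (δ ⊗ id)(id ⊗ Δ) from C ⊗_R C to C splits Δ and is colinear on both sides. Put κ(c₀ ⊗_H
c₁ ⊗ y) = φ(c₀ ⊗ c₁) ⊗_H y. Then κδ_0 = id because φΔ = id; κδ_1 = δ_0κ by right colinearity; for
the last cofaces, κτδ_0 = τδ_0κ by left colinearity; and κδ_{i+1} = δ_iκ is evident for the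
remaining i, where δ_{i+1} does not touch c₀ ⊗ c₁ (`contraction`). Hence κb + bκ = id and κb' + b'κ
= id in positive rows. In row 0, b' = δ_0 is injective since κδ_0 = id, so odd columns are acyclic,
while an even column has only ker b in row 0 as cohomology.

The passage to the total complex is done by hand. `exists_sub_d_row_zero` removes the rows of an
element from the top downwards, modulo coboundaries, until only row 0 is left. In odd degree what
remains is killed by the injective b', hence is zero; in even degree it lies in ker b. Conversely
ker b embeds, because τ = id in row 0 makes 1 - λ vanish there, and because a primitive of a row 0
element can itself be moved to row 0 of an odd column, where it must vanish. So `rowZero` identifies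
HC^n with ker b for every even n, including n = 0.

That the bicomplex is a bicomplex follows from four relations between cofaces and τ (`IsCocyclic`);
for a module coring these rest on coassociativity and on the rotation of tensors over `H`. -/

/-! ### Cancellation in signed double sums -/

/-- The terms at (j + 1, i) and (i, j) with i ≤ j cancel in pairs, and these pairs exhaust the
rectangle. This is the combinatorial content of bb = 0 and b'b' = 0. -/
theorem sum_eq_zero_of_succ_eq_neg {M : Type*} [AddCommGroup M]
    (F : ℕ → ℕ → M) (N : ℕ) (hF : ∀ i j, i ≤ j → j < N → F (j + 1) i = -F i j) :
    ∑ j ∈ Finset.range (N + 1), ∑ i ∈ Finset.range N, F j i = 0 := by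
  induction N with
  | zero => simp
  | succ N ih =>
    rw [Finset.sum_range_succ]
    rw [Finset.sum_congr rfl fun j _ => Finset.sum_range_succ (F j) N, Finset.sum_add_distrib,
      ih fun i j hij hj => hF i j hij (by omega), zero_add, ← Finset.sum_add_distrib]
    refine Finset.sum_eq_zero fun i hi => ?_
    rw [hF i N (by simpa [Nat.lt_succ_iff] using hi) (by omega), add_neg_cancel]

theorem linearMap_comp_sum {k M N P ι : Type*} [CommRing k] [AddCommGroup M] [Module k M]
    [AddCommGroup N] [Module k N] [AddCommGroup P] [Module k P] (g : N →ₗ[k] P) (s : Finset ι)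
    (f : ι → M →ₗ[k] N) : g ∘ₗ (∑ i ∈ s, f i) = ∑ i ∈ s, g ∘ₗ f i :=
  map_sum (LinearMap.llcomp k M N P g) f s

theorem linearMap_sum_comp {k M N P ι : Type*} [CommRing k] [AddCommGroup M] [Module k M]
    [AddCommGroup N] [Module k N] [AddCommGroup P] [Module k P] (g : M →ₗ[k] N) (s : Finset ι)
    (f : ι → N →ₗ[k] P) : (∑ i ∈ s, f i) ∘ₗ g = ∑ i ∈ s, f i ∘ₗ g :=
  map_sum (LinearMap.lcomp k P g) f s

/-! ### Abstract cocyclic modules and contractions -/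

namespace CocyclicData

variable {k : Type*} [CommRing k] (Z : CocyclicData.{v} k)

/-- The signed cofaces `(-1)^i δ_i`, continued by zero to all natural numbers `i`. -/
def signedCoface (n i : ℕ) : Z.X n →ₗ[k] Z.X (n + 1) :=
  if h : i < n + 2 then (-1 : k) ^ i • Z.coface n ⟨i, h⟩ else 0

theorem signedCoface_of_lt {n i : ℕ} (h : i < n + 2) :
    Z.signedCoface n i = (-1 : k) ^ i • Z.coface n ⟨i, h⟩ := dif_pos h

theorem signedCoface_zero (n : ℕ) : Z.signedCoface n 0 = Z.coface n 0 := by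
  rw [Z.signedCoface_of_lt (by omega)]
  simp

theorem b_eq_sum (n : ℕ) : Z.b n = ∑ i ∈ Finset.range (n + 2), Z.signedCoface n i := by
  rw [b, ← Fin.sum_univ_eq_sum_range]
  exact Finset.sum_congr rfl fun i _ => (Z.signedCoface_of_lt i.2).symm

theorem b'_eq_sum (n : ℕ) : Z.b' n = ∑ i ∈ Finset.range (n + 1), Z.signedCoface n i := by
  rw [b', ← Fin.sum_univ_eq_sum_range]
  exact Finset.sum_congr rfl fun i _ => (Z.signedCoface_of_lt i.castSucc.2).symm

/-- The relations between the cofaces and the cyclic operators of a cocyclic module. The other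
cosimplicial identities follow from these. -/
structure IsCocyclic : Prop where
  cyc_pow : ∀ n, Z.cyc n ^ (n + 1) = 1
  coface_last : ∀ n, Z.coface n (Fin.last (n + 1)) = Z.cyc (n + 1) ∘ₗ Z.coface n 0
  cyc_coface : ∀ n (j : Fin n),
    Z.cyc (n + 1) ∘ₗ Z.coface n j.castSucc.succ = Z.coface n j.castSucc.castSucc ∘ₗ Z.cyc n
  coface_coface_zero : ∀ n (j : Fin (n + 1)),
    Z.coface (n + 1) j.castSucc.succ ∘ₗ Z.coface n 0 = Z.coface (n + 1) 0 ∘ₗ Z.coface n j.castSucc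

/-- A contraction of the cofaces: `κ δ_0 = id` and `κ δ_{i+1} = δ_i κ`. -/
structure Contraction where
  toFun : ∀ n, Z.X (n + 1) →ₗ[k] Z.X n
  comp_coface_zero : ∀ n, toFun n ∘ₗ Z.coface n 0 = LinearMap.id
  comp_coface_succ : ∀ n (j : Fin (n + 2)),
    toFun (n + 1) ∘ₗ Z.coface (n + 1) j.succ = Z.coface n j ∘ₗ toFun n

variable {Z}

/-! ### Identities of the cyclic bicomplex -/

namespace IsCocyclic

variable (hZ : Z.IsCocyclic)
include hZ

theorem signedCyc_pow (n : ℕ) : Z.signedCyc n ^ (n + 1) = 1 := by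
  rw [signedCyc, smul_pow, hZ.cyc_pow, ← pow_mul, (Nat.even_mul_succ_self n).neg_one_pow, one_smul]

theorem signedCyc_zero : Z.signedCyc 0 = 1 := by
  simpa using hZ.signedCyc_pow 0

theorem signedCyc_mul_norm (n : ℕ) : Z.signedCyc n * Z.norm n = Z.norm n := by
  rw [norm, Finset.mul_sum]
  simp_rw [← pow_succ']
  rw [Finset.sum_range_succ, hZ.signedCyc_pow, Finset.sum_range_succ' _ n, pow_zero]

theorem norm_mul_signedCyc (n : ℕ) : Z.norm n * Z.signedCyc n = Z.norm n := by
  rw [norm, Finset.sum_mul]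
  simp_rw [← pow_succ]
  rw [Finset.sum_range_succ, hZ.signedCyc_pow, Finset.sum_range_succ' _ n, pow_zero]

theorem signedCyc_pow_mul_norm (n i : ℕ) : Z.signedCyc n ^ i * Z.norm n = Z.norm n := by
  induction i with
  | zero => simp
  | succ i ih => rw [pow_succ, mul_assoc, hZ.signedCyc_mul_norm, ih]

theorem norm_mul_signedCyc_pow (n i : ℕ) : Z.norm n * Z.signedCyc n ^ i = Z.norm n := by
  induction i with
  | zero => simp
  | succ i ih => rw [pow_succ', ← mul_assoc, hZ.norm_mul_signedCyc, ih]

/-- With d_i = (-1)^i δ_i and λ = (-1)^n τ the signs match: the relations become λd_0 = d_{n+1} and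
λd_{i+1} = d_iλ, with no sign left over. -/
theorem signedCyc_signedCoface_zero (n : ℕ) :
    Z.signedCyc (n + 1) ∘ₗ Z.signedCoface n 0 = Z.signedCoface n (n + 1) := by
  rw [Z.signedCoface_zero, Z.signedCoface_of_lt (by omega), signedCyc, LinearMap.smul_comp,
    ← hZ.coface_last]
  rfl

theorem signedCyc_signedCoface_succ_of_lt {n i : ℕ} (h : i < n) :
    Z.signedCyc (n + 1) ∘ₗ Z.signedCoface n (i + 1) = Z.signedCoface n i ∘ₗ Z.signedCyc n := by
  have e := hZ.cyc_coface n ⟨i, h⟩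
  rw [Z.signedCoface_of_lt (by omega), Z.signedCoface_of_lt (by omega), signedCyc, signedCyc]
  simp only [LinearMap.smul_comp, LinearMap.comp_smul]
  rw [show (⟨i + 1, by omega⟩ : Fin (n + 2)) = (Fin.castSucc ⟨i, h⟩).succ from rfl, e, smul_smul,
    smul_smul]
  congr 1
  ring

theorem signedCyc_pow_signedCoface_of_le {n i : ℕ} (h : i ≤ n) :
    (Z.signedCyc (n + 1) ^ i) ∘ₗ Z.signedCoface n i
      = Z.signedCoface n 0 ∘ₗ (Z.signedCyc n ^ i) := by
  induction i with
  | zero => rfl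
  | succ i ih =>
    rw [pow_succ, Module.End.mul_eq_comp, LinearMap.comp_assoc,
      hZ.signedCyc_signedCoface_succ_of_lt h, ← LinearMap.comp_assoc, ih (by omega),
      LinearMap.comp_assoc, ← Module.End.mul_eq_comp, ← pow_succ]

/-- Only i = n + 1 is new. There d_{n+1} = λd_0, and both λ^{n+2} on the target and λ^{n+1} on the
source are the identity. -/
theorem signedCyc_pow_signedCoface {n i : ℕ} (h : i ≤ n + 1) :
    (Z.signedCyc (n + 1) ^ i) ∘ₗ Z.signedCoface n i
      = Z.signedCoface n 0 ∘ₗ (Z.signedCyc n ^ i) := by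
  rcases Nat.lt_or_eq_of_le h with h | rfl
  · exact hZ.signedCyc_pow_signedCoface_of_le (by omega)
  · rw [← hZ.signedCyc_signedCoface_zero, ← LinearMap.comp_assoc, ← Module.End.mul_eq_comp,
      ← pow_succ, hZ.signedCyc_pow, hZ.signedCyc_pow]
    rfl

theorem signedCyc_pow_injective (n i : ℕ) {M : Type*} [AddCommGroup M] [Module k M]
    {f g : M →ₗ[k] Z.X n} (h : (Z.signedCyc n ^ i) ∘ₗ f = (Z.signedCyc n ^ i) ∘ₗ g) : f = g := by
  -- λ^{ni} inverts λ^i, since ni + i is a multiple of the order n + 1.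
  have e : Z.signedCyc n ^ (n * i) * Z.signedCyc n ^ i = 1 := by
    rw [← pow_add, show n * i + i = (n + 1) * i by ring, pow_mul, hZ.signedCyc_pow, one_pow]
  have e' := congrArg (fun u => (Z.signedCyc n ^ (n * i)) ∘ₗ u) h
  simpa only [← LinearMap.comp_assoc, ← Module.End.mul_eq_comp, e, Module.End.one_eq_id,
    LinearMap.id_comp] using e'

/-- The case i = n, for the last coface, is not among the axioms. After multiplication by the
invertible λ^i both sides become d_0λ^{i+1}. -/
theorem signedCyc_signedCoface_succ {n i : ℕ} (h : i ≤ n) :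
    Z.signedCyc (n + 1) ∘ₗ Z.signedCoface n (i + 1) = Z.signedCoface n i ∘ₗ Z.signedCyc n := by
  apply hZ.signedCyc_pow_injective _ i
  rw [← LinearMap.comp_assoc, ← LinearMap.comp_assoc, ← Module.End.mul_eq_comp, ← pow_succ,
    hZ.signedCyc_pow_signedCoface (by omega), hZ.signedCyc_pow_signedCoface (by omega),
    LinearMap.comp_assoc, pow_succ]
  rfl

theorem signedCyc_pow_signedCoface_add {n i j : ℕ} (h : i + j ≤ n + 1) :
    (Z.signedCyc (n + 1) ^ i) ∘ₗ Z.signedCoface n (i + j)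
      = Z.signedCoface n j ∘ₗ (Z.signedCyc n ^ i) := by
  induction i with
  | zero => rw [zero_add]; rfl
  | succ i ih =>
    rw [pow_succ, Module.End.mul_eq_comp, LinearMap.comp_assoc, show i + 1 + j = i + j + 1 by ring,
      hZ.signedCyc_signedCoface_succ (by omega), ← LinearMap.comp_assoc, ih (by omega),
      LinearMap.comp_assoc, ← Module.End.mul_eq_comp, ← pow_succ]

theorem signedCoface_signedCoface_zero_of_le {n j : ℕ} (h : j ≤ n) :
    Z.signedCoface (n + 1) (j + 1) ∘ₗ Z.signedCoface n 0
      = - Z.signedCoface (n + 1) 0 ∘ₗ Z.signedCoface n j := by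
  have e := hZ.coface_coface_zero n ⟨j, by omega⟩
  rw [Z.signedCoface_zero, Z.signedCoface_zero, Z.signedCoface_of_lt (by omega),
    Z.signedCoface_of_lt (by omega), LinearMap.smul_comp, LinearMap.comp_smul]
  rw [show (⟨j + 1, by omega⟩ : Fin (n + 1 + 2)) = (Fin.castSucc ⟨j, by omega⟩ : Fin (n + 2)).succ
    from rfl, e, pow_succ]
  simp

theorem signedCoface_signedCoface_zero {n j : ℕ} (h : j ≤ n + 1) :
    Z.signedCoface (n + 1) (j + 1) ∘ₗ Z.signedCoface n 0
      = - Z.signedCoface (n + 1) 0 ∘ₗ Z.signedCoface n j := by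
  rcases Nat.lt_or_eq_of_le h with h | rfl
  · exact hZ.signedCoface_signedCoface_zero_of_le (by omega)
  -- For the last coface: d_{n+2}d_0 = λd_0d_0 = -λd_1d_0 = -d_0λd_0 = -d_0d_{n+1}.
  · rw [← hZ.signedCyc_signedCoface_zero, ← hZ.signedCyc_signedCoface_zero,
      ← LinearMap.comp_assoc, ← hZ.signedCyc_signedCoface_succ (by omega), LinearMap.comp_assoc,
      LinearMap.comp_assoc, hZ.signedCoface_signedCoface_zero_of_le (by omega), LinearMap.comp_neg, neg_neg]

/-- The cosimplicial identities. -/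
theorem signedCoface_signedCoface {n i j : ℕ} (hij : i ≤ j) (hj : j ≤ n + 1) :
    Z.signedCoface (n + 1) (j + 1) ∘ₗ Z.signedCoface n i
      = - Z.signedCoface (n + 1) i ∘ₗ Z.signedCoface n j := by
  -- Multiplying by the invertible λ^i lowers both indices by i, which reduces the claim to
  -- d_{m+1}d_0 = -d_0d_m with m = j - i.
  obtain ⟨m, rfl⟩ := Nat.exists_eq_add_of_le hij
  apply hZ.signedCyc_pow_injective _ i
  rw [LinearMap.comp_neg, ← LinearMap.comp_assoc, ← LinearMap.comp_assoc,
    add_assoc i m 1, hZ.signedCyc_pow_signedCoface_add (by omega),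
    hZ.signedCyc_pow_signedCoface (by omega), LinearMap.comp_assoc, LinearMap.comp_assoc,
    hZ.signedCyc_pow_signedCoface_add (by omega), hZ.signedCyc_pow_signedCoface (by omega),
    ← LinearMap.comp_assoc, ← LinearMap.comp_assoc, hZ.signedCoface_signedCoface_zero (by omega),
    LinearMap.neg_comp]

theorem sum_signedCoface_comp (n N : ℕ) (hN : N ≤ n + 2) :
    (∑ j ∈ Finset.range (N + 1), Z.signedCoface (n + 1) j)
      ∘ₗ (∑ i ∈ Finset.range N, Z.signedCoface n i) = 0 := by
  rw [linearMap_sum_comp]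
  simp_rw [linearMap_comp_sum]
  exact sum_eq_zero_of_succ_eq_neg _ N fun i j hij hj =>
    hZ.signedCoface_signedCoface hij (by omega)

theorem b_comp_b (n : ℕ) : Z.b (n + 1) ∘ₗ Z.b n = 0 := by
  rw [b_eq_sum, b_eq_sum]
  exact hZ.sum_signedCoface_comp n (n + 2) le_rfl

theorem b'_comp_b' (n : ℕ) : Z.b' (n + 1) ∘ₗ Z.b' n = 0 := by
  rw [b'_eq_sum, b'_eq_sum]
  exact hZ.sum_signedCoface_comp n (n + 1) (by omega)

/-- Since λd_0 = d_{n+1} and λd_{i+1} = d_iλ, one has λb = b'λ + d_{n+1}, while b = b' + d_{n+1};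
the last cofaces cancel in the difference. -/
theorem signedCyc_comp_b (n : ℕ) :
    (1 - Z.signedCyc (n + 1)) ∘ₗ Z.b n = Z.b' n ∘ₗ (1 - Z.signedCyc n) := by
  have e : Z.signedCyc (n + 1) ∘ₗ Z.b n
      = Z.b' n ∘ₗ Z.signedCyc n + Z.signedCoface n (n + 1) := by
    rw [b_eq_sum, b'_eq_sum, Finset.sum_range_succ', LinearMap.comp_add,
      hZ.signedCyc_signedCoface_zero, linearMap_comp_sum, linearMap_sum_comp]
    congr 1
    refine Finset.sum_congr rfl fun i hi => hZ.signedCyc_signedCoface_succ ?_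
    simpa [Nat.lt_succ_iff] using hi
  have e' : Z.b n = Z.b' n + Z.signedCoface n (n + 1) := by
    rw [b_eq_sum, b'_eq_sum, Finset.sum_range_succ]
  rw [LinearMap.sub_comp, LinearMap.comp_sub, e, e', Module.End.one_eq_id, Module.End.one_eq_id,
    LinearMap.id_comp, LinearMap.comp_id]
  abel

/-- As N = Nλ^i, each Nd_i equals Nλ^id_i = Nd_0λ^i. Together with `b_comp_norm`, which has the same
right-hand side, this gives bN = Nb'. -/
theorem norm_comp_b' (n : ℕ) :
    Z.norm (n + 1) ∘ₗ Z.b' n = Z.norm (n + 1) ∘ₗ Z.signedCoface n 0 ∘ₗ Z.norm n := by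
  rw [b'_eq_sum, linearMap_comp_sum]
  conv_rhs => rw [norm.eq_1 Z n, linearMap_comp_sum, linearMap_comp_sum]
  refine Finset.sum_congr rfl fun i hi => ?_
  rw [← hZ.signedCyc_pow_signedCoface (Finset.mem_range.1 hi).le, ← LinearMap.comp_assoc,
    ← Module.End.mul_eq_comp, hZ.norm_mul_signedCyc_pow]

theorem b_comp_norm (n : ℕ) :
    Z.b n ∘ₗ Z.norm n = Z.norm (n + 1) ∘ₗ Z.signedCoface n 0 ∘ₗ Z.norm n := by
  have h1 : ∀ i ∈ Finset.range (n + 2), Z.signedCoface n i ∘ₗ Z.norm n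
      = (Z.signedCyc (n + 1) ^ (n + 2 - 1 - i + 1)) ∘ₗ Z.signedCoface n 0 ∘ₗ Z.norm n := by
    intro i hi
    have hi' : i < n + 2 := Finset.mem_range.1 hi
    -- λ^i is absorbed by N, so d_0N = d_0λ^iN = λ^id_iN. Thus d_iN = λ^{n+2-i}d_0N; the exponent is
    -- spelled n + 2 - 1 - i + 1 so that reversing the order of summation applies to it.
    have e : Z.signedCoface n 0 ∘ₗ Z.norm n
        = (Z.signedCyc (n + 1) ^ i) ∘ₗ Z.signedCoface n i ∘ₗ Z.norm n := by
      rw [← LinearMap.comp_assoc, hZ.signedCyc_pow_signedCoface (by omega), LinearMap.comp_assoc,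
        ← Module.End.mul_eq_comp, hZ.signedCyc_pow_mul_norm]
    rw [e, ← LinearMap.comp_assoc (Z.signedCoface n i ∘ₗ Z.norm n), ← Module.End.mul_eq_comp,
      ← pow_add, show n + 2 - 1 - i + 1 + i = n + 1 + 1 by omega, hZ.signedCyc_pow]
    rfl
  rw [b_eq_sum, linearMap_sum_comp, Finset.sum_congr rfl h1, ← linearMap_sum_comp,
    Finset.sum_range_reflect (fun i => Z.signedCyc (n + 1) ^ (i + 1)) (n + 2)]
  simp_rw [pow_succ]
  rw [← Finset.sum_mul]
  exact congrArg (· ∘ₗ _) (hZ.norm_mul_signedCyc (n + 1))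

theorem vert_vert (p q : ℕ) (x : Z.X q) : Z.vert p (q + 1) (Z.vert p q x) = 0 := by
  unfold vert
  split_ifs
  · exact LinearMap.congr_fun (hZ.b_comp_b q) x
  · simpa using LinearMap.congr_fun (hZ.b'_comp_b' q) x

theorem horiz_horiz (p q : ℕ) (x : Z.X q) : Z.horiz (p + 1) q (Z.horiz p q x) = 0 := by
  have h1 : Z.norm q * (1 - Z.signedCyc q) = 0 := by
    rw [mul_sub, mul_one, hZ.norm_mul_signedCyc, sub_self]
  have h2 : (1 - Z.signedCyc q) * Z.norm q = 0 := by
    rw [sub_mul, one_mul, hZ.signedCyc_mul_norm, sub_self]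
  unfold horiz
  by_cases hp : Even p
  · rw [if_pos hp, if_neg (by simpa [Nat.even_add_one] using hp)]
    exact LinearMap.congr_fun h1 x
  · rw [if_neg hp, if_pos (by simpa [Nat.even_add_one] using hp)]
    exact LinearMap.congr_fun h2 x

/-- The sign of -b' in odd columns turns the commutation relations (1 - λ)b = b'(1 - λ) and bN = Nb'
into anticommuting squares. -/
theorem vert_horiz (p q : ℕ) (x : Z.X q) :
    Z.vert (p + 1) q (Z.horiz p q x) + Z.horiz p (q + 1) (Z.vert p q x) = 0 := by
  unfold horiz vert
  by_cases hp : Even p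
  · rw [if_pos hp, if_neg (by simpa [Nat.even_add_one] using hp), if_pos hp, if_pos hp]
    have e := LinearMap.congr_fun (hZ.signedCyc_comp_b q) x
    simp only [LinearMap.comp_apply] at e
    rw [e]
    simp
  · rw [if_neg hp, if_pos (by simpa [Nat.even_add_one] using hp), if_neg hp, if_neg hp]
    have e := LinearMap.congr_fun ((hZ.b_comp_norm q).trans (hZ.norm_comp_b' q).symm) x
    simp only [LinearMap.comp_apply] at e
    rw [e]
    simp

theorem d_d (n : ℕ) {x : ∀ q, Z.X q} (hx : x ∈ Z.tot n) : Z.d (n + 1) (Z.d n x) = 0 := by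
  funext q
  change Z.dComp (n + 1) q (Z.d n x) = 0
  rcases q with _ | q
  · exact hZ.horiz_horiz n 0 (x 0)
  · change Z.vert (n + 1 - q) q (Z.dComp n q x)
      + Z.horiz (n + 1 - (q + 1)) (q + 1) (Z.vert (n - q) q (x q)
        + Z.horiz (n - (q + 1)) (q + 1) (x (q + 1))) = 0
    rw [Nat.add_sub_add_right, map_add, ← add_assoc]
    -- Column numbers are truncated differences, correct only for rows up to the degree; in higher
    -- rows the components of x vanish.
    have h1 : Z.horiz (n - q) (q + 1) (Z.horiz (n - (q + 1)) (q + 1) (x (q + 1))) = 0 := by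
      rcases Nat.lt_or_ge n (q + 1) with h | h
      · rw [hx _ h, map_zero, map_zero]
      · rw [show n - q = n - (q + 1) + 1 by omega]
        exact hZ.horiz_horiz _ _ _
    rw [h1, add_zero]
    -- Two consecutive vertical steps compose to zero, so only the horizontal part of row q
    -- survives.
    have h2 : Z.vert (n + 1 - q) q (Z.dComp n q x)
        = Z.vert (n + 1 - q) q (Z.horiz (n - q) q (x q)) := by
      rcases q with _ | q
      · rfl
      · change Z.vert (n + 1 - (q + 1)) (q + 1) (Z.vert (n - q) q (x q)
          + Z.horiz (n - (q + 1)) (q + 1) (x (q + 1))) = _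
        rw [map_add, Nat.add_sub_add_right, hZ.vert_vert, zero_add]
    rw [h2]
    rcases Nat.lt_or_ge n q with h | h
    · rw [hx _ h, map_zero, map_zero, map_zero, map_zero, add_zero]
    · rw [show n + 1 - q = n - q + 1 by omega]
      exact hZ.vert_horiz _ _ _

end IsCocyclic

/-! ### Vertical exactness from a contraction -/

namespace Contraction

variable (κ : Z.Contraction)
include κ

theorem comp_signedCoface_zero (n : ℕ) : κ.toFun n ∘ₗ Z.signedCoface n 0 = LinearMap.id := by
  rw [Z.signedCoface_zero, κ.comp_coface_zero]

theorem comp_signedCoface_succ {n i : ℕ} (h : i < n + 2) :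
    κ.toFun (n + 1) ∘ₗ Z.signedCoface (n + 1) (i + 1) = - Z.signedCoface n i ∘ₗ κ.toFun n := by
  have e := κ.comp_coface_succ n ⟨i, h⟩
  rw [Z.signedCoface_of_lt (by omega), Z.signedCoface_of_lt h, LinearMap.smul_comp,
    LinearMap.comp_smul, ← e, pow_succ]
  simp

/-- Here κd_0 = id and κd_{i+1} = -d_iκ. The bound N = n + 2 gives the homotopy for b, and N = n + 1
the one for b'. -/
theorem comp_sum_signedCoface (n N : ℕ) (hN : N ≤ n + 2) :
    κ.toFun (n + 1) ∘ₗ ∑ i ∈ Finset.range (N + 1), Z.signedCoface (n + 1) i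
      = LinearMap.id - (∑ i ∈ Finset.range N, Z.signedCoface n i) ∘ₗ κ.toFun n := by
  rw [Finset.sum_range_succ', LinearMap.comp_add, κ.comp_signedCoface_zero, linearMap_comp_sum,
    linearMap_sum_comp, add_comm _ LinearMap.id, sub_eq_add_neg, ← Finset.sum_neg_distrib]
  congr 1
  exact Finset.sum_congr rfl fun i hi =>
    κ.comp_signedCoface_succ ((Finset.mem_range.1 hi).trans_le hN)

theorem b_contraction (n : ℕ) (x : Z.X (n + 1)) :
    κ.toFun (n + 1) (Z.b (n + 1) x) = x - Z.b n (κ.toFun n x) := by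
  rw [b_eq_sum, b_eq_sum]
  exact LinearMap.congr_fun (κ.comp_sum_signedCoface n (n + 2) le_rfl) x

theorem b'_contraction (n : ℕ) (x : Z.X (n + 1)) :
    κ.toFun (n + 1) (Z.b' (n + 1) x) = x - Z.b' n (κ.toFun n x) := by
  rw [b'_eq_sum, b'_eq_sum]
  exact LinearMap.congr_fun (κ.comp_sum_signedCoface n (n + 1) (by omega)) x

/-- In row 0 the sum b' consists of δ_0 alone, which κ splits. For b the extra term δ_1 spoils this,
and ker b is what survives. -/
theorem b'_zero_injective {x : Z.X 0} (hx : Z.b' 0 x = 0) : x = 0 := by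
  have e := LinearMap.congr_fun (κ.comp_signedCoface_zero 0) x
  rw [b'_eq_sum, Finset.sum_range_one] at hx
  rw [LinearMap.comp_apply, hx, map_zero] at e
  exact e.symm

theorem exists_vert_eq (p m : ℕ) {w : Z.X (m + 1)} (hw : Z.vert p (m + 1) w = 0) :
    ∃ z, Z.vert p m z = w := by
  unfold vert at hw ⊢
  split_ifs at hw ⊢
  · have e := κ.b_contraction m w
    rw [hw, map_zero] at e
    exact ⟨_, (sub_eq_zero.1 e.symm).symm⟩
  · have e := κ.b'_contraction m w
    rw [LinearMap.neg_apply, neg_eq_zero] at hw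
    rw [hw, map_zero] at e
    refine ⟨-κ.toFun m w, ?_⟩
    rw [LinearMap.neg_apply, map_neg, neg_neg]
    exact (sub_eq_zero.1 e.symm).symm

/-- In positive degree, an element of the total complex whose differential is concentrated in row
`0` is, up to a coboundary, concentrated in row `0`. -/
theorem exists_sub_d_row_zero (hZ : Z.IsCocyclic) (M m : ℕ) :
    ∀ x ∈ Z.tot (M + 1), (∀ q, m < q → x q = 0) → (∀ q, Z.d (M + 1) x (q + 1) = 0) →
      ∃ y ∈ Z.tot M, ∀ q, (x - Z.d M y) (q + 1) = 0 := by
  induction m with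
  | zero => exact fun x _ hx _ => ⟨0, zero_mem _, fun q => by simp [hx]⟩
  | succ m ih =>
    intro x hxt hx hd
    rcases Nat.lt_or_ge M m with hm | hm
    · refine ih x hxt (fun q hq => ?_) hd
      exact hxt q (by omega)
    -- Row m + 1 is the top row, so the differential of x in row m + 2 is the vertical image of its
    -- entry, which therefore vanishes.
    · have hv : Z.vert (M - m) (m + 1) (x (m + 1)) = 0 := by
        have e : Z.vert (M + 1 - (m + 1)) (m + 1) (x (m + 1))
            + Z.horiz (M + 1 - (m + 1 + 1)) (m + 1 + 1) (x (m + 1 + 1)) = 0 := hd (m + 1)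
        rwa [hx (m + 1 + 1) (by omega), map_zero, add_zero, Nat.add_sub_add_right] at e
      obtain ⟨z, hz⟩ := κ.exists_vert_eq _ _ hv
      -- The vertical primitive z sits in row m and column M - m, hence in degree M. Its total
      -- differential cancels row m + 1 and otherwise changes only row m.
      have hy : Pi.single m z ∈ Z.tot M := fun q hq => Pi.single_eq_of_ne (by omega) z
      have h1 : ∀ q, m < q → (x - Z.d M (Pi.single m z)) q = 0 := by
        intro q hq
        obtain ⟨q, rfl⟩ : ∃ r, q = r + 1 := ⟨q - 1, by omega⟩
        have e : Z.d M (Pi.single m z) (q + 1) = Z.vert (M - q) q (Pi.single m z q)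
            + Z.horiz (M - (q + 1)) (q + 1) (Pi.single m z (q + 1)) := rfl
        rw [Pi.sub_apply, e, Pi.single_eq_of_ne (show q + 1 ≠ m by omega), map_zero, add_zero]
        rcases Nat.lt_or_ge m q with h | h
        · rw [Pi.single_eq_of_ne (by omega), map_zero, sub_zero]
          exact hx _ (by omega)
        · obtain rfl : q = m := by omega
          rw [Pi.single_eq_same, hz, sub_self]
      obtain ⟨y, hyt, hy'⟩ := ih (x - Z.d M (Pi.single m z))
        (fun q hq => h1 q (by omega)) h1
        (fun q => by rw [map_sub, hZ.d_d M hy, sub_zero, hd])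
      refine ⟨Pi.single m z + y, add_mem hy hyt, fun q => ?_⟩
      rw [map_add, ← sub_sub]
      exact hy' q

end Contraction

/-! ### Reduction of the total cohomology to row 0 -/

theorem eq_single_zero {x : ∀ q, Z.X q} (hx : ∀ q, x (q + 1) = 0) : x = Pi.single 0 (x 0) := by
  funext q
  rcases q with _ | q
  · simp
  · rw [hx, Pi.single_eq_of_ne (by omega)]

theorem d_single_zero_zero (n : ℕ) (x : Z.X 0) : Z.d n (Pi.single 0 x) 0 = Z.horiz n 0 x := by
  change Z.horiz n 0 (Pi.single 0 x 0) = _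
  rw [Pi.single_eq_same]

theorem d_single_zero_one (n : ℕ) (x : Z.X 0) : Z.d n (Pi.single 0 x) 1 = Z.vert n 0 x := by
  change Z.vert n 0 (Pi.single 0 x 0) + Z.horiz (n - 1) 1 (Pi.single 0 x 1) = _
  rw [Pi.single_eq_same, Pi.single_eq_of_ne (by omega), map_zero, add_zero]

theorem d_single_zero_add_two (n q : ℕ) (x : Z.X 0) : Z.d n (Pi.single 0 x) (q + 2) = 0 := by
  change Z.vert (n - (q + 1)) (q + 1) (Pi.single 0 x (q + 1))
    + Z.horiz (n - (q + 2)) (q + 2) (Pi.single 0 x (q + 2)) = _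
  rw [Pi.single_eq_of_ne (by omega), Pi.single_eq_of_ne (by omega), map_zero, map_zero, add_zero]

theorem single_zero_mem_tot (n : ℕ) (x : Z.X 0) : Pi.single 0 x ∈ Z.tot n :=
  fun _ hq => Pi.single_eq_of_ne (by omega) x

/-- Every class in positive degree is represented by an element concentrated in row `0`. -/
theorem Contraction.exists_sub_d_eq_single (κ : Z.Contraction) (hZ : Z.IsCocyclic) {M : ℕ}
    {x : ∀ q, Z.X q} (hx : x ∈ Z.cocycles (M + 1)) :
    ∃ y ∈ Z.tot M, ∃ z, x - Z.d M y = Pi.single 0 z ∧ Z.vert (M + 1) 0 z = 0 := by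
  have hd : Z.d (M + 1) x = 0 := hx.2
  obtain ⟨y, hy, h⟩ := κ.exists_sub_d_row_zero hZ M (M + 1) x hx.1 hx.1
    (fun q => by rw [hd]; rfl)
  refine ⟨y, hy, _, eq_single_zero h, ?_⟩
  rw [← d_single_zero_one, ← eq_single_zero h, map_sub, hd, hZ.d_d M hy, sub_zero]
  rfl

theorem Contraction.subsingleton_HC (κ : Z.Contraction) (hZ : Z.IsCocyclic) {n : ℕ} (hn : Odd n) :
    Subsingleton (Z.HC n) := by
  refine Submodule.Quotient.subsingleton_iff.2 (eq_top_iff.2 ?_)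
  rintro ⟨x, hx⟩ -
  obtain ⟨M, rfl⟩ : ∃ M, n = M + 1 := ⟨n - 1, by have := hn.pos; omega⟩
  obtain ⟨y, hy, z, hz, hv⟩ := κ.exists_sub_d_eq_single hZ hx
  rw [vert, if_neg (Nat.not_even_iff_odd.2 hn), LinearMap.neg_apply, neg_eq_zero] at hv
  rw [κ.b'_zero_injective hv, Pi.single_zero] at hz
  exact ⟨y, hy, (sub_eq_zero.1 hz).symm⟩

/-- Out of an even column the horizontal map is 1 - λ, and λ = 1 in row 0, so the vertical condition
is the only one. -/
theorem IsCocyclic.single_zero_mem_cocycles (hZ : Z.IsCocyclic) {n : ℕ} (hn : Even n) {x : Z.X 0}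
    (hx : Z.b 0 x = 0) : Pi.single 0 x ∈ Z.cocycles n := by
  refine ⟨single_zero_mem_tot n x, ?_⟩
  refine LinearMap.mem_ker.2 ?_
  funext q
  rcases q with _ | _ | q
  · rw [d_single_zero_zero, horiz, if_pos hn, hZ.signedCyc_zero, sub_self]
    rfl
  · rw [d_single_zero_one, vert, if_pos hn, hx]
    rfl
  · exact d_single_zero_add_two n q x

/-- In even degrees, the classes of the elements concentrated in row `0`. -/
def IsCocyclic.rowZero (hZ : Z.IsCocyclic) {n : ℕ} (hn : Even n) :
    LinearMap.ker (Z.b 0) →ₗ[k] Z.HC n :=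
  Submodule.mkQ _ ∘ₗ LinearMap.codRestrict (Z.cocycles n)
    (LinearMap.single k Z.X 0 ∘ₗ (LinearMap.ker (Z.b 0)).subtype)
    (fun x => hZ.single_zero_mem_cocycles hn x.2)

theorem IsCocyclic.rowZero_apply (hZ : Z.IsCocyclic) {n : ℕ} (hn : Even n)
    (x : LinearMap.ker (Z.b 0)) :
    hZ.rowZero hn x = Submodule.Quotient.mk (p := (Z.coboundaries n).submoduleOf (Z.cocycles n))
      ⟨Pi.single 0 x.1, hZ.single_zero_mem_cocycles hn x.2⟩ := rfl

theorem Contraction.rowZero_surjective (κ : Z.Contraction) (hZ : Z.IsCocyclic) {n : ℕ}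
    (hn : Even n) : Function.Surjective (hZ.rowZero hn) := by
  intro c
  obtain ⟨⟨x, hx⟩, rfl⟩ := Submodule.mkQ_surjective _ c
  rcases n with _ | M
  · have h0 : x = Pi.single 0 (x 0) := eq_single_zero fun q => hx.1 _ (by omega)
    have hd : Z.d 0 x = 0 := hx.2
    have hb : Z.b 0 (x 0) = 0 := by
      have e := d_single_zero_one 0 (x 0)
      rw [← h0, hd, vert, if_pos Even.zero] at e
      exact e.symm
    refine ⟨⟨x 0, hb⟩, congrArg (Submodule.mkQ _) (Subtype.ext ?_)⟩
    exact h0.symm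
  · obtain ⟨y, hy, z, hz, hv⟩ := κ.exists_sub_d_eq_single hZ hx
    rw [vert, if_pos hn] at hv
    refine ⟨⟨z, hv⟩, ?_⟩
    rw [hZ.rowZero_apply]
    refine ((Submodule.Quotient.eq _).2 ?_).symm
    refine ⟨y, hy, ?_⟩
    change Z.d M y = x - Pi.single 0 z
    rw [← hz, sub_sub_cancel]

theorem Contraction.rowZero_injective (κ : Z.Contraction) (hZ : Z.IsCocyclic) {n : ℕ}
    (hn : Even n) : Function.Injective (hZ.rowZero hn) := by
  rw [← LinearMap.ker_eq_bot, LinearMap.ker_eq_bot']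
  rintro ⟨x, hx⟩ h
  rw [hZ.rowZero_apply] at h
  have h' : Pi.single 0 x ∈ Z.coboundaries n :=
    (Submodule.Quotient.mk_eq_zero ((Z.coboundaries n).submoduleOf (Z.cocycles n))
      (x := ⟨Pi.single 0 x, hZ.single_zero_mem_cocycles hn hx⟩)).1 h
  refine Subtype.ext (?_ : x = 0)
  rcases n with _ | _ | M
  · exact (Pi.single_eq_zero_iff).1 h'
  · simp at hn
  · obtain ⟨y, hy, hyx⟩ := h'
    have hM : ¬ Even (M + 1) := by simpa [Nat.even_add_one] using hn
    have hyd : Z.d (M + 1) y = Pi.single 0 x := hyx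
    -- The primitive y is not a cocycle, but its differential lives in row 0, which suffices to move
    -- y to row 0 of the odd column M + 1. There the row 1 part of the equation says b' = 0, so y
    -- becomes zero, and x with it.
    obtain ⟨w, hw, hr⟩ := κ.exists_sub_d_row_zero hZ M (M + 1) y hy hy
      (fun q => by rw [hyd, Pi.single_eq_of_ne (by omega)])
    have e : Z.d (M + 1) (y - Z.d M w) = Pi.single 0 x := by
      rw [map_sub, hZ.d_d M hw, sub_zero, hyd]
    rw [eq_single_zero hr] at e
    have e1 := congrFun e 1
    rw [d_single_zero_one, vert, if_neg hM, Pi.single_eq_of_ne (by omega), LinearMap.neg_apply,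
      neg_eq_zero] at e1
    rw [κ.b'_zero_injective e1, Pi.single_zero, map_zero] at e
    exact (Pi.single_eq_zero_iff).1 e.symm

theorem Contraction.nonempty_HC_equiv (κ : Z.Contraction) (hZ : Z.IsCocyclic) {n : ℕ}
    (hn : Even n) : Nonempty (Z.HC n ≃ₗ[k] Z.HC 0) :=
  ⟨(LinearEquiv.ofBijective (hZ.rowZero hn)
      ⟨κ.rowZero_injective hZ hn, κ.rowZero_surjective hZ hn⟩).symm.trans
    (LinearEquiv.ofBijective (hZ.rowZero Even.zero)
      ⟨κ.rowZero_injective hZ Even.zero, κ.rowZero_surjective hZ Even.zero⟩)⟩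

end CocyclicData
-- Contraction of tensor factors over `H`
section Contractions

variable {k R H M N P Q : Type*} [CommRing k] [Ring R] [Algebra k R] [Ring H] [Algebra k H]
  [AddCommGroup M] [Module k M] [AddCommGroup N] [Module k N] [AddCommGroup P] [Module k P]
  [AddCommGroup Q] [Module k Q]
  {π : H →ₐ[k] Module.End k M} {σ : H →ₐ[k] Module.End k N}
  {τ : H →ₐ[k] Module.End k P} {ω : H →ₐ[k] Module.End k Q}

/-- The map `M ⊗_H N → N ⊗_H M`, `m ⊗ n ↦ n ⊗ m`. -/
def ParaHopfAlgebroid.hswap (A : ParaHopfAlgebroid k R H) (π : H →ₐ[k] Module.End k M)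
    (σ : H →ₐ[k] Module.End k N) : A.HTen π σ →ₗ[k] A.HTen σ π :=
  Bal.lift (A.htmul σ π).flip (fun h m n => (A.htmul_bal σ π h n m).symm)

@[simp] theorem ParaHopfAlgebroid.hswap_mk (A : ParaHopfAlgebroid k R H) (m : M) (n : N) :
    A.hswap π σ (A.htmul π σ m n) = A.htmul σ π n m :=
  Bal.lift_mk _ _ m n

/-- The map `M ⊗_H (N ⊗_R P) → Q ⊗_H P`, `m ⊗ (n ⊗ p) ↦ f(m ⊗ n) ⊗ p`. -/
def ParaHopfAlgebroid.hcontract (A : ParaHopfAlgebroid k R H) (f : HHom (A.tens π σ) ω)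
    (τ : H →ₐ[k] Module.End k P) : A.HTen π (A.tens σ τ) →ₗ[k] A.HTen ω τ :=
  -- Two rotations give p ⊗_H (m ⊗ n), which brings the arguments of f together. Well-definedness
  -- over `H` is thus inherited from `rot`, and no inverse of `hassoc` is needed.
  A.hswap τ ω ∘ₗ A.hmap (HHom.id τ) f ∘ₗ A.rot σ τ π ∘ₗ A.rot π σ τ

theorem ParaHopfAlgebroid.hcontract_mk (A : ParaHopfAlgebroid k R H) (f : HHom (A.tens π σ) ω)
    (m : M) (n : N) (p : P) :
    A.hcontract f τ (A.htmul π (A.tens σ τ) m (A.tmul σ τ n p))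
      = A.htmul ω τ (f.toLin (A.tmul π σ m n)) p := by
  simp only [ParaHopfAlgebroid.hcontract, LinearMap.comp_apply]
  rw [A.rot_mk, A.rot_mk, A.hmap_mk, A.hswap_mk]
  rfl

theorem ParaHopfAlgebroid.hcontract_hassocAux (A : ParaHopfAlgebroid k R H)
    (f : HHom (A.tens π σ) ω) (z : A.Ten π σ) (p : P) :
    A.hcontract f τ (A.hassocAux π σ τ z p) = A.htmul ω τ (f.toLin z) p := by
  induction z using Bal.ind with
  | h_mk m n => rw [A.hassocAux_mk, A.hcontract_mk]
  | h_sum x y hx hy => simp only [map_add, LinearMap.add_apply, hx, hy]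

theorem ParaHopfAlgebroid.tmul_triv (A : ParaHopfAlgebroid k R H) (m : M) (r : R) :
    A.tmul π A.triv m r = A.tmul π A.triv (π (A.β (MulOpposite.op r)) m) 1 := by
  rw [A.tmul_bal, A.triv_apply, map_one, mul_one, A.counit_α]

/-- Writing m ⊗ r as β(r)m ⊗ 1 reduces the claim to h(m ⊗ 1) = hm ⊗ 1, a form of the counit axiom.
-/
theorem ParaHopfAlgebroid.runit_act (A : ParaHopfAlgebroid k R H) (h : H) (z : A.Ten π A.triv) :
    A.runit π (A.tens π A.triv h z) = π h (A.runit π z) := by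
  induction z using Bal.ind with
  | h_mk m r =>
    change A.runit π (A.tens π A.triv h (A.tmul π A.triv m r))
      = π h (A.runit π (A.tmul π A.triv m r))
    rw [A.tmul_triv, A.tens_mk, A.id_counit_pair, A.runit_mk, A.runit_mk, MulOpposite.op_one,
      map_one, map_one]
    rfl
  | h_sum x y hx hy => simp only [map_add, hx, hy]

/-- The `H`-linear map `M ⊗_R R → M`, `m ⊗ r ↦ β(r) m`. -/
def ParaHopfAlgebroid.runitHom (A : ParaHopfAlgebroid k R H) (π : H →ₐ[k] Module.End k M) :
    HHom (A.tens π A.triv) π := ⟨A.runit π, A.runit_act⟩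

end Contractions

section Cyclic

variable {k H : Type*} {R C : Type v} [CommRing k] [Ring R] [Algebra k R] [Ring H] [Algebra k H]
  [AddCommGroup C] [Module k C]

/-! ### Elementary tensors and the order of τ -/

section Words

variable (A : ParaHopfAlgebroid k R H) (π : H →ₐ[k] Module.End k C)

/-- The element `f 0 ⊗ f 1 ⊗ ⋯ ⊗ f (n - 1)` of `C^{⊗_R n}`. -/
def ParaHopfAlgebroid.word : (n : ℕ) → (ℕ → C) → (A.pow π n).carrier
  | 0, _ => (1 : R)
  | n + 1, f => A.tmul π (A.pow π n).act (f 0) (ParaHopfAlgebroid.word n fun i => f (i + 1))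

theorem ParaHopfAlgebroid.word_succ (n : ℕ) (f : ℕ → C) :
    A.word π (n + 1) f
      = A.tmul π (A.pow π n).act (f 0) (A.word π n fun i => f (i + 1)) := rfl

theorem ParaHopfAlgebroid.word_congr (n : ℕ) {f g : ℕ → C} (h : ∀ i < n, f i = g i) :
    A.word π n f = A.word π n g := by
  induction n generalizing f g with
  | zero => rfl
  | succ n ih =>
    rw [A.word_succ, A.word_succ, h 0 (by omega), ih fun i hi => h (i + 1) (by omega)]

theorem ParaHopfAlgebroid.append_word (n : ℕ) (f : ℕ → C) :
    (A.append π n).toLin (A.tmul (A.pow π n).act π (A.word π n f) (f n))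
      = A.word π (n + 1) f := by
  induction n generalizing f with
  | zero =>
    refine (A.append_zero_mk (π := π) 1 (f 0)).trans ?_
    have e : π (A.α 1) (f 0) = f 0 := by
      rw [map_one, map_one]
      rfl
    exact congrArg (fun c => A.tmul π A.triv c 1) e
  | succ n ih =>
    refine (A.append_succ_mk n _ _ _).trans ?_
    exact congrArg _ (ih fun i => f (i + 1))

theorem ParaHopfAlgebroid.tau_word (n : ℕ) {f : ℕ → C} (hf : f (n + 2) = f 0) :
    A.tau π (n + 1) (A.htmul π (A.pow π (n + 1)).act (f 0) (A.word π (n + 1) fun i => f (i + 1)))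
      = A.htmul π (A.pow π (n + 1)).act (f 1) (A.word π (n + 1) fun i => f (i + 2)) := by
  refine (A.tau_mk n _ _ _).trans ?_
  rw [← hf]
  exact congrArg _ (A.append_word π n fun i => f (i + 2))

/-- On elementary tensors read off from a sequence of period n + 2, τ is the shift of the sequence.
-/
theorem ParaHopfAlgebroid.tau_pow_word (n m : ℕ) {f : ℕ → C} (hf : ∀ i, f (i + (n + 2)) = f i) :
    (A.tau π (n + 1) ^ m)
        (A.htmul π (A.pow π (n + 1)).act (f 0) (A.word π (n + 1) fun i => f (i + 1)))
      = A.htmul π (A.pow π (n + 1)).act (f m) (A.word π (n + 1) fun i => f (i + (m + 1))) := by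
  induction m with
  | zero => rfl
  | succ m ih =>
    rw [pow_succ', Module.End.mul_apply, ih]
    have e := A.tau_word π n (f := fun i => f (i + m))
      (by simpa [add_comm, add_left_comm] using hf m)
    simpa [add_comm, add_left_comm, add_assoc] using e

/-- At least one factor is needed: it absorbs the trailing element of `R` by c ⊗ r = β(r)c ⊗ 1. With
no factor the only word is 1, which need not span `R` over `k`. -/
theorem ParaHopfAlgebroid.span_word (n : ℕ) :
    Submodule.span k (Set.range (A.word π (n + 1))) = ⊤ := by
  induction n with
  | zero =>
    refine Submodule.eq_top_iff'.2 fun z => ?_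
    induction z using Bal.ind with
    | h_mk c r =>
      refine Submodule.subset_span ⟨fun _ => π (A.β (MulOpposite.op r)) c, ?_⟩
      exact (A.tmul_triv c r).symm
    | h_sum x y hx hy => exact add_mem hx hy
  | succ n ih =>
    refine Submodule.eq_top_iff'.2 fun z => ?_
    induction z using Bal.ind with
    | h_mk c y =>
      have hy : y ∈ Submodule.span k (Set.range (A.word π (n + 1))) := ih ▸ Submodule.mem_top
      change A.tmul π (A.pow π (n + 1)).act c y ∈ _
      induction hy using Submodule.span_induction with
      | mem y hy =>
        obtain ⟨f, rfl⟩ := hy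
        exact Submodule.subset_span ⟨fun i => Nat.casesOn i c f, rfl⟩
      | zero => rw [map_zero]; exact zero_mem _
      | add x y _ _ hx hy => rw [map_add]; exact add_mem hx hy
      | smul a x _ hx => rw [map_smul]; exact Submodule.smul_mem _ _ hx
    | h_sum x y hx hy => exact add_mem hx hy

theorem ParaHopfAlgebroid.tau_pow (n : ℕ) : A.tau π n ^ (n + 1) = 1 := by
  rcases n with _ | n
  · exact one_pow _
  · refine Bal.hom_ext fun c y => ?_
    have hy : y ∈ Submodule.span k (Set.range (A.word π (n + 1))) :=
      A.span_word π n ▸ Submodule.mem_top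
    change (A.tau π (n + 1) ^ (n + 1 + 1)) (A.htmul π (A.pow π (n + 1)).act c y)
      = A.htmul π (A.pow π (n + 1)).act c y
    induction hy using Submodule.span_induction with
    | mem y hy =>
      obtain ⟨f, rfl⟩ := hy
      -- The periodic extension of c, f 0, …, f n, with period n + 2.
      let g : ℕ → C := fun i => Nat.casesOn (i % (n + 2)) c f
      have hg : ∀ i, g (i + (n + 2)) = g i := fun i => by simp [g]
      have h0 : g 0 = c := by simp [g]
      have h1 : A.word π (n + 1) f = A.word π (n + 1) fun i => g (i + 1) :=
        A.word_congr π _ fun i hi => by simp [g, Nat.mod_eq_of_lt (show i + 1 < n + 2 by omega)]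
      have e := A.tau_pow_word π n (n + 2) hg
      rw [h1, ← h0]
      refine e.trans ?_
      have h2 : g (n + 2) = g 0 := by simpa using hg 0
      rw [h2]
      congr 2
      funext i
      rw [← hg (i + 1)]
      exact congrArg g (by omega)
    | zero => rw [map_zero, map_zero]
    | add x y _ _ hx hy => rw [map_add, map_add, hx, hy]
    | smul a x _ hx => rw [map_smul, map_smul, hx]

end Words

/-! ### Coring axioms in terms of `H`-modules -/

section Coring

variable {A : ParaHopfAlgebroid k R H} {π : H →ₐ[k] Module.End k C} (K : ModuleCoring A π)

theorem ModuleCoring.coassoc (c : C) :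
    A.mapLin (HHom.id π) K.Δ (K.coring.comul c)
      = A.assocLin π π π (A.mapLin K.Δ (HHom.id π) (K.coring.comul c)) := by
  let B := A.bimod π
  -- The coring axiom uses the bimodule structure of `B.tensor B`, the claim the one induced by the
  -- diagonal `H`-action. They agree, and G is the identity on elements between the two resulting
  -- triple tensor products.
  let G : B.Ten (B.tensor B) →ₗ[k] A.Ten π (A.tens π π) :=
    Bal.map LinearMap.id LinearMap.id (fun _ _ => rfl) (fun a z => by
      induction z using Bal.ind with
      | h_mk m n => exact (Bimod.tensor_l B B a m n).trans (A.tens_α π π a m n).symm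
      | h_sum x y hx hy => simp only [map_add, hx, hy])
  have hG : ∀ (m : C) (z : B.Ten B), G (B.tmul (B.tensor B) m z) = A.tmul π (A.tens π π) m z :=
    fun m z => Bal.map_mk _ _ _ _ m z
  have h1 : ∀ z : B.Ten B, G ((Bal.map LinearMap.id K.coring.comul (fun _ _ => rfl)
      K.coring.comul_l : B.Ten B →ₗ[k] B.Ten (B.tensor B)) z) = A.mapLin (HHom.id π) K.Δ z := by
    intro z
    induction z using Bal.ind with
    | h_mk m n =>
      rw [Bal.map_mk]
      exact (hG _ _).trans (A.mapLin_mk (HHom.id π) K.Δ m n).symm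
    | h_sum x y hx hy => simp only [map_add, hx, hy]
  have h2 : ∀ (z : B.Ten B) (d : C), G (B.assoc ((B.tensor B).tmul B z d))
      = A.assocLin π π π (A.tmul (A.tens π π) π z d) := by
    intro z d
    induction z using Bal.ind with
    | h_mk m n =>
      refine (congrArg G (Bal.assoc_mk _ _ _ _ m n d)).trans ?_
      exact (hG _ _).trans (A.assocLin_mk π π π m n d).symm
    | h_sum x y hx hy => simp only [map_add, LinearMap.add_apply, hx, hy]
  have h3 : ∀ z : B.Ten B, G (B.assoc ((Bal.map K.coring.comul LinearMap.id
      (fun _ => K.coring.comul_r _) (fun _ _ => rfl) :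
        B.Ten B →ₗ[k] (B.tensor B).Ten B) z))
      = A.assocLin π π π (A.mapLin K.Δ (HHom.id π) z) := by
    intro z
    induction z using Bal.ind with
    | h_mk m n =>
      rw [Bal.map_mk]
      exact (h2 _ _).trans (congrArg _ (A.mapLin_mk K.Δ (HHom.id π) m n).symm)
    | h_sum x y hx hy => simp only [map_add, hx, hy]
  rw [← h1, ← h3, K.coring.coassoc]

theorem ParaHopfAlgebroid.assocInv_assocLin (A : ParaHopfAlgebroid k R H)
    (π : H →ₐ[k] Module.End k C) (z : A.Ten (A.tens π π) π) :
    A.assocInv π π π (A.assocLin π π π z) = z := by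
  induction z using Bal.ind with
  | h_mk z p =>
    induction z using Bal.ind with
    | h_mk m n =>
      exact (congrArg _ (A.assocLin_mk π π π m n p)).trans (A.assocInv_mk π π π m n p)
    | h_sum x y hx hy => simp only [map_add, LinearMap.add_apply, hx, hy]
  | h_sum x y hx hy => simp only [map_add, hx, hy]

theorem ModuleCoring.coassoc' (c : C) :
    A.mapLin K.Δ (HHom.id π) (K.coring.comul c)
      = A.assocInv π π π (A.mapLin (HHom.id π) K.Δ (K.coring.comul c)) := by
  rw [K.coassoc, A.assocInv_assocLin]

theorem ModuleCoring.runit_counit (c : C) :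
    A.runit π (A.mapLin (HHom.id π) K.ε (K.coring.comul c)) = c := by
  conv_rhs => rw [← K.coring.id_counit c]
  generalize K.coring.comul c = z
  induction z using Bal.ind with
  | h_mk m n =>
    rw [Bal.map_mk]
    refine (congrArg _ (A.mapLin_mk (HHom.id π) K.ε m n)).trans ((A.runit_mk _ _).trans ?_)
    exact (Bimod.runit_mk (A.bimod π) m (K.coring.counit n)).symm
  | h_sum x y hx hy => simp only [map_add, hx, hy]

/-! ### The bicolinear retraction of Δ -/

section Coseparable

variable {N : Type*} [AddCommGroup N] [Module k N] (δ : HHom (A.tens π π) A.triv)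

/-- The map `C ⊗_R N → N`, `p ⊗ n ↦ δ(c ⊗ p) n`. -/
def ParaHopfAlgebroid.contractLeft (σ : H →ₐ[k] Module.End k N) (c : C) : A.Ten π σ →ₗ[k] N :=
  A.lunit σ ∘ₗ A.mapLin δ (HHom.id σ) ∘ₗ A.assocInv π π σ ∘ₗ A.tmul π (A.tens π σ) c

theorem ParaHopfAlgebroid.contractLeft_mk (σ : H →ₐ[k] Module.End k N) (c p : C) (n : N) :
    ParaHopfAlgebroid.contractLeft δ σ c (A.tmul π σ p n)
      = σ (A.α (δ.toLin (A.tmul π π c p))) n := by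
  simp only [ParaHopfAlgebroid.contractLeft, LinearMap.comp_apply]
  rw [A.assocInv_mk, A.mapLin_mk, A.lunit_mk]
  rfl

/-- The map `N ⊗_R C → N`, `n ⊗ p ↦ n δ(p ⊗ d)`. -/
def ParaHopfAlgebroid.contractRight (σ : H →ₐ[k] Module.End k N) (d : C) : A.Ten σ π →ₗ[k] N :=
  A.runit σ ∘ₗ A.mapLin (HHom.id σ) δ ∘ₗ A.assocLin σ π π ∘ₗ (A.tmul (A.tens σ π) π).flip d

theorem ParaHopfAlgebroid.contractRight_mk (σ : H →ₐ[k] Module.End k N) (d p : C) (n : N) :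
    ParaHopfAlgebroid.contractRight δ σ d (A.tmul σ π n p)
      = σ (A.β (MulOpposite.op (δ.toLin (A.tmul π π p d)))) n := by
  simp only [ParaHopfAlgebroid.contractRight, LinearMap.comp_apply, LinearMap.flip_apply]
  rw [A.assocLin_mk, A.mapLin_mk, A.runit_mk]
  rfl

/-- The `H`-linear map `(id ⊗ δ)(Δ ⊗ id) : C ⊗_R C → C`. -/
def ModuleCoring.retraction : HHom (A.tens π π) π :=
  (A.runitHom π).comp ((A.map (HHom.id π) δ).comp
    ((A.assoc π π π).comp (A.map K.Δ (HHom.id π))))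

theorem ModuleCoring.retraction_eq_contractRight (c d : C) :
    (K.retraction δ).toLin (A.tmul π π c d)
      = ParaHopfAlgebroid.contractRight δ π d (K.coring.comul c) :=
  congrArg (fun z => A.runit π (A.mapLin (HHom.id π) δ (A.assocLin π π π z)))
    (A.mapLin_mk K.Δ (HHom.id π) c d)

variable {δ}

/-- By coassociativity φΔ = (id ⊗ δΔ)Δ = (id ⊗ ε)Δ, and the counit axiom applies. -/
theorem ModuleCoring.retraction_comul (hδ : ∀ c, δ.toLin (K.Δ.toLin c) = K.ε.toLin c) (c : C) :
    (K.retraction δ).toLin (K.coring.comul c) = c := by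
  change A.runit π (A.mapLin (HHom.id π) δ (A.assocLin π π π
    (A.mapLin K.Δ (HHom.id π) (K.coring.comul c)))) = c
  rw [← K.coassoc]
  conv_rhs => rw [← K.runit_counit c]
  generalize K.coring.comul c = z
  induction z using Bal.ind with
  | h_mk m n =>
    refine (congrArg (fun z => A.runit π (A.mapLin (HHom.id π) δ z))
      (A.mapLin_mk (HHom.id π) K.Δ m n)).trans ?_
    refine (congrArg (A.runit π) (A.mapLin_mk (HHom.id π) δ m (K.Δ.toLin n))).trans ?_
    rw [hδ]
    exact congrArg (A.runit π) (A.mapLin_mk (HHom.id π) K.ε m n).symm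
  | h_sum x y hx hy => simp only [map_add, hx, hy]

/-- `retraction` is left colinear: `Δ(φ(c ⊗ d)) = c⁽¹⁾ ⊗ φ(c⁽²⁾ ⊗ d)`. -/
theorem ModuleCoring.comul_retraction_left (c d : C) :
    K.coring.comul ((K.retraction δ).toLin (A.tmul π π c d))
      = A.mapLin (HHom.id π) (K.retraction δ)
          (A.assocLin π π π (A.tmul (A.tens π π) π (K.coring.comul c) d)) := by
  -- Contraction with d is natural in the left-hand module, hence commutes with the `H`-linear Δ.
  -- Given this, left colinearity is coassociativity and does not use the two-sided identity for δ.
  have h1 : ∀ w : A.Ten π π, K.coring.comul (ParaHopfAlgebroid.contractRight δ π d w)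
      = ParaHopfAlgebroid.contractRight δ (A.tens π π) d (A.mapLin K.Δ (HHom.id π) w) := by
    intro w
    induction w using Bal.ind with
    | h_mk p q =>
      refine (congrArg _ (ParaHopfAlgebroid.contractRight_mk δ π d q p)).trans ?_
      rw [K.comul_act]
      refine Eq.trans ?_ (congrArg _ (A.mapLin_mk K.Δ (HHom.id π) p q).symm)
      exact (ParaHopfAlgebroid.contractRight_mk δ (A.tens π π) d q (K.coring.comul p)).symm
    | h_sum x y hx hy => simp only [map_add, hx, hy]
  have h2 : ∀ (p : C) (w : A.Ten π π),
      A.tmul π π p (ParaHopfAlgebroid.contractRight δ π d w)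
        = ParaHopfAlgebroid.contractRight δ (A.tens π π) d
            (A.assocInv π π π (A.tmul π (A.tens π π) p w)) := by
    intro p w
    induction w using Bal.ind with
    | h_mk u v =>
      refine (congrArg _ (ParaHopfAlgebroid.contractRight_mk δ π d v u)).trans ?_
      refine Eq.trans ?_ (congrArg _ (A.assocInv_mk π π π p u v).symm)
      exact ((ParaHopfAlgebroid.contractRight_mk δ (A.tens π π) d v _).trans
        (A.tens_β π π _ p u)).symm
    | h_sum x y hx hy => simp only [map_add, hx, hy]
  have h3 : ∀ w : A.Ten π π, A.mapLin (HHom.id π) (K.retraction δ)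
        (A.assocLin π π π (A.tmul (A.tens π π) π w d))
      = ParaHopfAlgebroid.contractRight δ (A.tens π π) d
          (A.assocInv π π π (A.mapLin (HHom.id π) K.Δ w)) := by
    intro w
    induction w using Bal.ind with
    | h_mk p q =>
      refine (congrArg _ (A.assocLin_mk π π π p q d)).trans ?_
      refine (A.mapLin_mk (HHom.id π) (K.retraction δ) p (A.tmul π π q d)).trans ?_
      rw [K.retraction_eq_contractRight]
      refine (h2 p (K.coring.comul q)).trans ?_
      exact congrArg _ (congrArg _ (A.mapLin_mk (HHom.id π) K.Δ p q).symm)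
    | h_sum x y hx hy => simp only [map_add, LinearMap.add_apply, hx, hy]
  rw [h3, ← K.coassoc', K.retraction_eq_contractRight, h1]

section Colinear

variable (hδ : ∀ z : A.Ten π π,
  A.runit π (A.mapLin (HHom.id π) δ (A.assocLin π π π (A.mapLin K.Δ (HHom.id π) z)))
    = A.lunit π (A.mapLin δ (HHom.id π) (A.assocInv π π π (A.mapLin (HHom.id π) K.Δ z))))
include hδ

/-- This is the two-sided identity of coseparability. It gives φ a second formula, from which right
colinearity follows as left colinearity does from the first. -/
theorem ModuleCoring.retraction_eq_contractLeft (c d : C) :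
    (K.retraction δ).toLin (A.tmul π π c d)
      = ParaHopfAlgebroid.contractLeft δ π c (K.coring.comul d) :=
  (hδ (A.tmul π π c d)).trans
    (congrArg (fun z => A.lunit π (A.mapLin δ (HHom.id π) (A.assocInv π π π z)))
      (A.mapLin_mk (HHom.id π) K.Δ c d))

/-- `retraction` is right colinear: `Δ(φ(c ⊗ d)) = φ(c ⊗ d⁽¹⁾) ⊗ d⁽²⁾`. -/
theorem ModuleCoring.comul_retraction_right (c d : C) :
    K.coring.comul ((K.retraction δ).toLin (A.tmul π π c d))
      = A.mapLin (K.retraction δ) (HHom.id π)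
          (A.assocInv π π π (A.tmul π (A.tens π π) c (K.coring.comul d))) := by
  have h1 : ∀ w : A.Ten π π, K.coring.comul (ParaHopfAlgebroid.contractLeft δ π c w)
      = ParaHopfAlgebroid.contractLeft δ (A.tens π π) c (A.mapLin (HHom.id π) K.Δ w) := by
    intro w
    induction w using Bal.ind with
    | h_mk p q =>
      refine (congrArg _ (ParaHopfAlgebroid.contractLeft_mk δ π c p q)).trans ?_
      rw [K.comul_act]
      refine Eq.trans ?_ (congrArg _ (A.mapLin_mk (HHom.id π) K.Δ p q).symm)
      exact (ParaHopfAlgebroid.contractLeft_mk δ (A.tens π π) c p (K.coring.comul q)).symm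
    | h_sum x y hx hy => simp only [map_add, hx, hy]
  have h2 : ∀ (w : A.Ten π π) (q : C),
      A.tmul π π (ParaHopfAlgebroid.contractLeft δ π c w) q
        = ParaHopfAlgebroid.contractLeft δ (A.tens π π) c
            (A.assocLin π π π (A.tmul (A.tens π π) π w q)) := by
    intro w q
    induction w using Bal.ind with
    | h_mk u v =>
      refine (congrArg (fun x => A.tmul π π x q)
        (ParaHopfAlgebroid.contractLeft_mk δ π c u v)).trans ?_
      refine Eq.trans ?_ (congrArg _ (A.assocLin_mk π π π u v q).symm)
      exact ((ParaHopfAlgebroid.contractLeft_mk δ (A.tens π π) c u _).trans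
        (A.tens_α π π _ v q)).symm
    | h_sum x y hx hy => simp only [map_add, LinearMap.add_apply, hx, hy]
  have h3 : ∀ w : A.Ten π π, A.mapLin (K.retraction δ) (HHom.id π)
        (A.assocInv π π π (A.tmul π (A.tens π π) c w))
      = ParaHopfAlgebroid.contractLeft δ (A.tens π π) c
          (A.assocLin π π π (A.mapLin K.Δ (HHom.id π) w)) := by
    intro w
    induction w using Bal.ind with
    | h_mk p q =>
      refine (congrArg _ (A.assocInv_mk π π π c p q)).trans ?_
      refine (A.mapLin_mk (K.retraction δ) (HHom.id π) (A.tmul π π c p) q).trans ?_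
      rw [K.retraction_eq_contractLeft hδ]
      refine (h2 (K.coring.comul p) q).trans ?_
      exact congrArg _ (congrArg _ (A.mapLin_mk K.Δ (HHom.id π) p q).symm)
    | h_sum x y hx hy => simp only [map_add, hx, hy]
  rw [h3, ← K.coassoc, K.retraction_eq_contractLeft hδ, h1]

end Colinear

end Coseparable

end Coring

end Cyclic
-- The cocyclic relations for a module coring
section HopfCyclicCohomology

variable {k H : Type*} {R C : Type v} [CommRing k] [Ring R] [Algebra k R] [Ring H] [Algebra k H]
  [AddCommGroup C] [Module k C]
  {A : ParaHopfAlgebroid k R H} {π : H →ₐ[k] Module.End k C} (K : ModuleCoring A π)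

variable (A π) in
/-- The map `(c, y) ↦ c ⊗ y`. -/
def ParaHopfAlgebroid.cons (n : ℕ) :
    C →ₗ[k] (A.pow π n).carrier →ₗ[k] (A.pow π (n + 1)).carrier :=
  A.tmul π (A.pow π n).act

variable (A π) in
/-- The map `(y, c) ↦ y ⊗ c`. -/
def ParaHopfAlgebroid.snoc (n : ℕ) :
    (A.pow π n).carrier →ₗ[k] C →ₗ[k] (A.pow π (n + 1)).carrier :=
  (A.tmul (A.pow π n).act π).compr₂ (A.append π n).toLin

variable (A π) in
/-- The map `(p ⊗ q, y) ↦ p ⊗ (q ⊗ y)`. -/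
def ParaHopfAlgebroid.consPair (n : ℕ) :
    A.Ten π π →ₗ[k] (A.pow π n).carrier →ₗ[k] (A.pow π (n + 2)).carrier :=
  (A.tmul (A.tens π π) (A.pow π n).act).compr₂ (A.assocLin π π (A.pow π n).act)

variable (A π) in
/-- The element `c ⊗_H y` of `C^n`. -/
def ParaHopfAlgebroid.hcons (n : ℕ) : C →ₗ[k] (A.pow π n).carrier →ₗ[k] A.cochain π n :=
  A.htmul π (A.pow π n).act

variable (A π) in
/-- The map `(p ⊗ q, y) ↦ p ⊗_H (q ⊗ y)`. -/
def ParaHopfAlgebroid.hconsPair (n : ℕ) :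
    A.Ten π π →ₗ[k] (A.pow π n).carrier →ₗ[k] A.cochain π (n + 1) :=
  A.hassocAux π π (A.pow π n).act

theorem ParaHopfAlgebroid.pow_ind {n : ℕ} {motive : (A.pow π (n + 1)).carrier → Prop}
    (y : (A.pow π (n + 1)).carrier) (h_cons : ∀ c y, motive (A.cons π n c y))
    (h_sum : ∀ x y, motive x → motive y → motive (x + y)) : motive y :=
  Bal.ind y h_cons h_sum

theorem ParaHopfAlgebroid.cochain_hom_ext {n : ℕ} {P : Type*} [AddCommGroup P] [Module k P]
    {f g : A.cochain π n →ₗ[k] P} (h : ∀ c y, f (A.hcons π n c y) = g (A.hcons π n c y)) :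
    f = g :=
  Bal.hom_ext h

theorem ParaHopfAlgebroid.consPair_mk (n : ℕ) (p q : C) (y : (A.pow π n).carrier) :
    A.consPair π n (A.tmul π π p q) y = A.cons π (n + 1) p (A.cons π n q y) :=
  A.assocLin_mk π π (A.pow π n).act p q y

theorem ParaHopfAlgebroid.hconsPair_mk (n : ℕ) (p q : C) (y : (A.pow π n).carrier) :
    A.hconsPair π n (A.tmul π π p q) y = A.hcons π (n + 1) p (A.cons π n q y) :=
  A.hassocAux_mk p q y

theorem ParaHopfAlgebroid.snoc_cons (n : ℕ) (c d : C) (y : (A.pow π n).carrier) :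
    A.snoc π (n + 1) (A.cons π n c y) d = A.cons π (n + 1) c (A.snoc π n y d) :=
  A.append_succ_mk n c d y

theorem ParaHopfAlgebroid.snoc_consPair (n : ℕ) (z : A.Ten π π) (y : (A.pow π n).carrier)
    (c : C) : A.snoc π (n + 2) (A.consPair π n z y) c = A.consPair π (n + 1) z (A.snoc π n y c) := by
  induction z using Bal.ind with
  | h_mk p q => rw [A.consPair_mk, A.consPair_mk, A.snoc_cons, A.snoc_cons]
  | h_sum x y hx hy => simp only [map_add, LinearMap.add_apply, hx, hy]

theorem ParaHopfAlgebroid.tau_hcons (n : ℕ) (c d : C) (y : (A.pow π n).carrier) :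
    A.tau π (n + 1) (A.hcons π (n + 1) c (A.cons π n d y)) = A.hcons π (n + 1) d (A.snoc π n y c) :=
  A.tau_mk n c d y

theorem ParaHopfAlgebroid.tau_hcons_consPair (n : ℕ) (c : C) (z : A.Ten π π)
    (y : (A.pow π n).carrier) :
    A.tau π (n + 2) (A.hcons π (n + 2) c (A.consPair π n z y))
      = A.hconsPair π (n + 1) z (A.snoc π n y c) := by
  induction z using Bal.ind with
  | h_mk p q => rw [A.consPair_mk, A.hconsPair_mk, A.tau_hcons, A.snoc_cons]
  | h_sum x y hx hy => simp only [map_add, LinearMap.add_apply, hx, hy]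

theorem ModuleCoring.comulAt_zero_cons (n : ℕ) (c : C) (y : (A.pow π n).carrier) :
    (K.comulAt (n + 1) 0).toLin (A.cons π n c y) = A.consPair π n (K.coring.comul c) y :=
  K.comulAt_zero_mk n c y

theorem ModuleCoring.comulAt_succ_cons (n : ℕ) (i : Fin n) (c : C) (y : (A.pow π n).carrier) :
    (K.comulAt (n + 1) i.succ).toLin (A.cons π n c y)
      = A.cons π (n + 1) c ((K.comulAt n i).toLin y) :=
  K.comulAt_succ_mk n i c y

/-- Since τ appends c₀ at the end, this is what carries a coface acting on an inner factor past τ.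
-/
theorem ModuleCoring.comulAt_snoc (n : ℕ) (i : Fin n) (y : (A.pow π n).carrier) (c : C) :
    (K.comulAt (n + 1) i.castSucc).toLin (A.snoc π n y c)
      = A.snoc π (n + 1) ((K.comulAt n i).toLin y) c := by
  induction n with
  | zero => exact i.elim0
  | succ n ih =>
    induction y using ParaHopfAlgebroid.pow_ind with
    | h_cons d y =>
      rw [A.snoc_cons]
      cases i using Fin.cases with
      | zero => rw [Fin.castSucc_zero, K.comulAt_zero_cons, K.comulAt_zero_cons, A.snoc_consPair]
      | succ i =>
        rw [← Fin.succ_castSucc, K.comulAt_succ_cons, K.comulAt_succ_cons, ih, A.snoc_cons]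
    | h_sum x y hx hy => simp only [map_add, LinearMap.add_apply, hx, hy]

theorem ModuleCoring.coface_zero_hcons (n : ℕ) (c : C) (y : (A.pow π n).carrier) :
    K.coface n 0 (A.hcons π n c y) = A.hconsPair π n (K.coring.comul c) y :=
  K.coface_zero_mk n c y

theorem ModuleCoring.coface_mid_hcons (n : ℕ) (j : Fin n) (c : C) (y : (A.pow π n).carrier) :
    K.coface n j.castSucc.succ (A.hcons π n c y)
      = A.hcons π (n + 1) c ((K.comulAt n j).toLin y) := by
  rw [K.coface_mid]
  exact A.hmap_mk _ _ _ _

theorem ModuleCoring.cyc_coface (n : ℕ) (j : Fin n) :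
    A.tau π (n + 1) ∘ₗ K.coface n j.castSucc.succ
      = K.coface n j.castSucc.castSucc ∘ₗ A.tau π n := by
  rcases n with _ | n
  · exact j.elim0
  refine A.cochain_hom_ext fun c y => ?_
  rw [LinearMap.comp_apply, LinearMap.comp_apply]
  induction y using ParaHopfAlgebroid.pow_ind with
  | h_cons d y =>
    rw [K.coface_mid_hcons, A.tau_hcons]
    cases j using Fin.cases with
    -- Here Δ hits c₁, which τ moves to the front, so that δ_1 becomes δ_0.
    | zero =>
      rw [K.comulAt_zero_cons, A.tau_hcons_consPair, Fin.castSucc_zero, Fin.castSucc_zero,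
        K.coface_zero_hcons]
    | succ i =>
      rw [K.comulAt_succ_cons, A.tau_hcons, ← K.comulAt_snoc, ← Fin.succ_castSucc,
        ← Fin.succ_castSucc, K.coface_mid_hcons]
  | h_sum x y hx hy => simp only [map_add, hx, hy]

variable (A π) in
/-- The map `p ⊗ (q ⊗ r) ↦ p ⊗_H (q ⊗ (r ⊗ y))`. -/
def ParaHopfAlgebroid.hconsTriple (n : ℕ) (y : (A.pow π n).carrier) :
    A.Ten π (A.tens π π) →ₗ[k] A.cochain π (n + 2) :=
  A.hmap (HHom.id π) (A.assoc π π (A.pow π n).act)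
    ∘ₗ (A.hassocAux π (A.tens π π) (A.pow π n).act).flip y

theorem ParaHopfAlgebroid.hconsTriple_mk (n : ℕ) (p : C) (z : A.Ten π π)
    (y : (A.pow π n).carrier) :
    A.hconsTriple π n y (A.tmul π (A.tens π π) p z) = A.hcons π (n + 2) p (A.consPair π n z y) :=
  (congrArg _ (A.hassocAux_mk p z y)).trans (A.hmap_mk _ _ _ _)

theorem ParaHopfAlgebroid.hconsTriple_assocLin (n : ℕ) (z : A.Ten π π) (q : C)
    (y : (A.pow π n).carrier) :
    A.hconsTriple π n y (A.assocLin π π π (A.tmul (A.tens π π) π z q))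
      = A.hconsPair π (n + 1) z (A.cons π n q y) := by
  induction z using Bal.ind with
  | h_mk u v => rw [A.hconsPair_mk, A.assocLin_mk, A.hconsTriple_mk, A.consPair_mk]
  | h_sum x y hx hy => simp only [map_add, LinearMap.add_apply, hx, hy]

/-- With `coface_zero_hconsPair` this expresses δ_1δ_0 and δ_0δ_0 through one map on C ⊗ (C ⊗ C), so
that their equality is coassociativity. -/
theorem ModuleCoring.coface_one_hconsPair (n : ℕ) (z : A.Ten π π) (y : (A.pow π n).carrier) :
    K.coface (n + 1) (0 : Fin (n + 1)).castSucc.succ (A.hconsPair π n z y)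
      = A.hconsTriple π n y (A.mapLin (HHom.id π) K.Δ z) := by
  induction z using Bal.ind with
  | h_mk p q =>
    rw [A.hconsPair_mk, A.mapLin_mk, A.hconsTriple_mk, K.coface_mid_hcons, K.comulAt_zero_cons]
    rfl
  | h_sum x y hx hy => simp only [map_add, LinearMap.add_apply, hx, hy]

theorem ModuleCoring.coface_zero_hconsPair (n : ℕ) (z : A.Ten π π) (y : (A.pow π n).carrier) :
    K.coface (n + 1) 0 (A.hconsPair π n z y)
      = A.hconsTriple π n y (A.assocLin π π π (A.mapLin K.Δ (HHom.id π) z)) := by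
  induction z using Bal.ind with
  | h_mk p q =>
    rw [A.hconsPair_mk, A.mapLin_mk, A.hconsTriple_assocLin, K.coface_zero_hcons]
    rfl
  | h_sum x y hx hy => simp only [map_add, LinearMap.add_apply, hx, hy]

theorem ModuleCoring.coface_coface_zero (n : ℕ) (j : Fin (n + 1)) :
    K.coface (n + 1) j.castSucc.succ ∘ₗ K.coface n 0
      = K.coface (n + 1) 0 ∘ₗ K.coface n j.castSucc := by
  refine A.cochain_hom_ext fun c y => ?_
  rw [LinearMap.comp_apply, LinearMap.comp_apply, K.coface_zero_hcons]
  cases j using Fin.cases with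
  | zero =>
    rw [K.coface_one_hconsPair, Fin.castSucc_zero, K.coface_zero_hcons, K.coface_zero_hconsPair,
      K.coassoc]
  | succ i =>
    rw [← Fin.succ_castSucc, K.coface_mid_hcons, K.coface_zero_hcons]
    generalize K.coring.comul c = z
    induction z using Bal.ind with
    | h_mk p q =>
      rw [A.hconsPair_mk, A.hconsPair_mk, Fin.succ_castSucc, K.coface_mid_hcons,
        K.comulAt_succ_cons]
    | h_sum x y hx hy => simp only [map_add, LinearMap.add_apply, hx, hy]

theorem ModuleCoring.isCocyclic : K.cocyclic.IsCocyclic where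
  cyc_pow := A.tau_pow π
  coface_last := K.coface_last
  cyc_coface := K.cyc_coface
  coface_coface_zero := K.coface_coface_zero

/-- The map `C^{n+1} → C^n`, `c ⊗_H (d ⊗ y) ↦ f(c ⊗ d) ⊗_H y`. -/
def ParaHopfAlgebroid.contractCochain (f : HHom (A.tens π π) π) (n : ℕ) :
    A.cochain π (n + 1) →ₗ[k] A.cochain π n :=
  A.hcontract f (A.pow π n).act

/-! ### The contraction of the cocyclic module -/

section Contraction

variable (f : HHom (A.tens π π) π)

theorem ParaHopfAlgebroid.contractCochain_hcons (n : ℕ) (c d : C) (y : (A.pow π n).carrier) :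
    A.contractCochain f n (A.hcons π (n + 1) c (A.cons π n d y))
      = A.hcons π n (f.toLin (A.tmul π π c d)) y :=
  A.hcontract_mk f c d y

theorem ParaHopfAlgebroid.contractCochain_hconsPair (n : ℕ) (z : A.Ten π π)
    (y : (A.pow π n).carrier) :
    A.contractCochain f n (A.hconsPair π n z y) = A.hcons π n (f.toLin z) y :=
  A.hcontract_hassocAux f z y

theorem ParaHopfAlgebroid.contractCochain_hcons_consPair (n : ℕ) (c : C) (z : A.Ten π π)
    (y : (A.pow π n).carrier) :
    A.contractCochain f (n + 1) (A.hcons π (n + 2) c (A.consPair π n z y))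
      = A.hconsPair π n
          (A.mapLin f (HHom.id π) (A.assocInv π π π (A.tmul π (A.tens π π) c z))) y := by
  induction z using Bal.ind with
  | h_mk p q =>
    rw [A.consPair_mk, A.assocInv_mk, A.mapLin_mk, A.hconsPair_mk, A.contractCochain_hcons]
    rfl
  | h_sum x y hx hy => simp only [map_add, LinearMap.add_apply, hx, hy]

/-- For z = p ⊗ q, both sides are f(q ⊗ d) ⊗_H (y ⊗ p): the rotation sends p to the far end, out of
reach of the contraction. -/
theorem ParaHopfAlgebroid.contractCochain_tau (n : ℕ) (z : A.Ten π π) (d : C)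
    (y : (A.pow π n).carrier) :
    A.contractCochain f (n + 1) (A.tau π (n + 2) (A.hconsPair π (n + 1) z (A.cons π n d y)))
      = A.tau π (n + 1) (A.hconsPair π n
          (A.mapLin (HHom.id π) f (A.assocLin π π π (A.tmul (A.tens π π) π z d))) y) := by
  induction z using Bal.ind with
  | h_mk p q =>
    rw [A.hconsPair_mk, A.assocLin_mk, A.mapLin_mk, A.hconsPair_mk, A.tau_hcons, A.snoc_cons,
      A.tau_hcons, A.contractCochain_hcons]
    rfl
  | h_sum x y hx hy => simp only [map_add, LinearMap.add_apply, hx, hy]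

end Contraction

variable {K} {δ : HHom (A.tens π π) A.triv}

/-- The contraction `c ⊗_H (d ⊗ y) ↦ φ(c ⊗ d) ⊗_H y` given by the colinear retraction `φ` of `Δ`
that is associated with an `H`-coseparability map. -/
def ModuleCoring.contraction (hε : ∀ c, δ.toLin (K.Δ.toLin c) = K.ε.toLin c)
    (hδ : ∀ z : A.Ten π π,
      A.runit π (A.mapLin (HHom.id π) δ (A.assocLin π π π (A.mapLin K.Δ (HHom.id π) z)))
        = A.lunit π (A.mapLin δ (HHom.id π) (A.assocInv π π π (A.mapLin (HHom.id π) K.Δ z)))) :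
    K.cocyclic.Contraction where
  toFun n := A.contractCochain (K.retraction δ) n
  comp_coface_zero n := A.cochain_hom_ext fun c y => by
    change A.contractCochain (K.retraction δ) n (K.coface n 0 (A.hcons π n c y)) = A.hcons π n c y
    rw [K.coface_zero_hcons, A.contractCochain_hconsPair, K.retraction_comul hε]
  comp_coface_succ n j := A.cochain_hom_ext fun c y => by
    change A.contractCochain (K.retraction δ) (n + 1) (K.coface (n + 1) j.succ
        (A.hcons π (n + 1) c y))
      = K.coface n j (A.contractCochain (K.retraction δ) n (A.hcons π (n + 1) c y))
    induction y using ParaHopfAlgebroid.pow_ind with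
    | h_cons d y =>
      rw [A.contractCochain_hcons]
      cases j using Fin.lastCases with
      | last =>
        -- Both sides are φ(c⁽²⁾ ⊗ d) ⊗_H (y ⊗ c⁽¹⁾), by left colinearity.
        rw [Fin.succ_last, K.coface_last, K.coface_last, LinearMap.comp_apply,
          LinearMap.comp_apply, K.coface_zero_hcons, K.coface_zero_hcons, K.comul_retraction_left,
          A.contractCochain_tau]
      | cast j =>
        rw [K.coface_mid_hcons]
        cases j using Fin.cases with
        | zero =>
          -- Both sides are φ(c ⊗ d⁽¹⁾) ⊗_H (d⁽²⁾ ⊗ y), by right colinearity.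
          rw [K.comulAt_zero_cons, Fin.castSucc_zero, K.coface_zero_hcons,
            K.comul_retraction_right hδ, A.contractCochain_hcons_consPair]
        | succ i =>
          rw [K.comulAt_succ_cons, ← Fin.succ_castSucc, K.coface_mid_hcons,
            A.contractCochain_hcons]
    | h_sum x y hx hy => simp only [map_add, hx, hy]

end HopfCyclicCohomology

end HopfCyclic

end

theorem proposition3p4 {k : Type*} {H : Type*} {R C : Type v}
    [Field k] [Ring R] [Algebra k R] [Ring H] [Algebra k H]
    (A : HopfCyclic.ParaHopfAlgebroid k R H)
    [AddCommGroup C] [Module k C] [Module H C] [IsScalarTower k H C]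
    (K : HopfCyclic.ModuleCoring A (Algebra.lsmul k k C : H →ₐ[k] Module.End k C))
    (hK : K.IsCoseparable) (n : ℕ) :
    (Even n → Nonempty (K.HC n ≃ₗ[k] K.HC 0)) ∧ (Odd n → Subsingleton (K.HC n)) := by
  obtain ⟨δ, hε, hδ⟩ := hK
  exact ⟨(HopfCyclic.ModuleCoring.contraction hε hδ).nonempty_HC_equiv K.isCocyclic,
    (HopfCyclic.ModuleCoring.contraction hε hδ).subsingleton_HC K.isCocyclic⟩
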